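/- Let $\Lambda\subset\mathbb R^n$ be a Delone set (uniformly discrete and relatively dense), let $\mu=\sum_{\lambda\in\Lambda}\delta_\lambda$, and assume that $\Lambda$ is Bohr almost periodic: for every continuous compactly supported $f:\mathbb R^n\to\mathbb C$ the function $(\mu*f)(x)=\sum_{\lambda\in\Lambda}f(x-\lambda)$ is a uniform limit on $\mathbb R^n$ of finite linear combinations of characters $\chi_y(x)=e^{2\pi i\langle y,x\rangle}$, $y\in\mathbb R^n$. Let $\rho_m:\mathbb R^m\to\mathbb T^m$, $\rho_m(x)=(e^{2\pi i x_1},\dots,e^{2\pi i x_m})$, and let $\psi:\mathbb R^n\to\mathbb T^m$ be a continuous homomorphism with dense image, written as $\psi=\rho_m\circ M$ with $M:\mathbb R^n\to\mathbb R^m$ linear. Assume that $\Lambda$ is of toral type with associated compactification $(\mathbb T^m,\psi)$, in the sense that the spectrum $$\Omega(\mu)=\Big\{y\in\mathbb R^n:\ \lim_{R\to\infty}\frac{1}{\operatorname{vol}B(0,R)}\sum_{\lambda\in\Lambda\cap B(0,R)}\chi_{-y}(\lambda)\ \text{ exists and is nonzero}\Big\}$$ is contained in $M^{T}\mathbb Z^m$.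 Put $K=\overline{\psi(\Lambda)}\subset\mathbb T^m$, $V=M\mathbb R^n\subset\mathbb R^m$, and let $U=V^\perp$ be the orthogonal complement of $V$. Then $\dim U=m-n$ (in particular $m\ge n$). Moreover, for every connected component $K_c$ of $K$ and every connected component $H_c$ of $\rho_m^{-1}(K_c)\subset\mathbb R^m$ there is a continuous map $h:U\to V$ such that $u\mapsto h(u)+u$ is a homeomorphism of $U$ onto $H_c$. So $H_c$ is the graph of a continuous function over the $(m-n)$-dimensional transversal $U$. -/

import Mathlib

noncomputable section

/-- The character `χ_y(x) = e^{2πi⟨y, x⟩}` of `ℝⁿ`. -/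
def character {n : ℕ} (y x : EuclideanSpace ℝ (Fin n)) : ℂ :=
  Complex.exp (2 * Real.pi * Complex.I * ((inner ℝ y x : ℝ) : ℂ))

/-- Bohr almost periodic functions: the uniform closure, among the functions on `ℝⁿ`, of the
space of trigonometric polynomials. -/
def IsBohrAlmostPeriodicFun {n : ℕ} (F : EuclideanSpace ℝ (Fin n) → ℂ) : Prop :=
  ∀ ε : ℝ, 0 < ε → ∃ P ∈ Submodule.span ℂ (Set.range (character (n := n))),
    ∀ x, ‖F x - P x‖ < ε

/-- The convolution `μ * f` of `μ = ∑_{p ∈ Λ} δ_p` with `f`, that is,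
`(μ * f)(x) = ∑_{p ∈ Λ} f (x - p)`. For `Λ` locally finite and `f` of compact support, the sum has
finitely many nonzero terms. -/
def convolve {n : ℕ} (Λ : Set (EuclideanSpace ℝ (Fin n)))
    (f : EuclideanSpace ℝ (Fin n) → ℂ) (x : EuclideanSpace ℝ (Fin n)) : ℂ :=
  ∑ᶠ p ∈ Λ, f (x - p)

/-- `Λ`, with all multiplicities one, is Bohr almost periodic: `μ * f` is a Bohr almost periodic
function for every continuous `f` of compact support. -/
def IsBohrAlmostPeriodicSet {n : ℕ} (Λ : Set (EuclideanSpace ℝ (Fin n))) : Prop :=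
  ∀ f : EuclideanSpace ℝ (Fin n) → ℂ, Continuous f → HasCompactSupport f →
    IsBohrAlmostPeriodicFun (convolve Λ f)

/-- The averages `(∑_{p ∈ Λ ∩ B(0,R)} χ_{-y}(p)) / vol B(0,R)` whose limit as `R → ∞` is the
Fourier coefficient of `μ = ∑_{p ∈ Λ} δ_p` at `y`. -/
def ballAverage {n : ℕ} (Λ : Set (EuclideanSpace ℝ (Fin n)))
    (y : EuclideanSpace ℝ (Fin n)) (R : ℝ) : ℂ :=
  (∑ᶠ p ∈ Λ ∩ Metric.ball 0 R, character (-y) p) /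
    (((MeasureTheory.volume (Metric.ball (0 : EuclideanSpace ℝ (Fin n)) R)).toReal : ℝ) : ℂ)

/-- The spectrum of `μ = ∑_{p ∈ Λ} δ_p`: the set of `y` at which the Fourier coefficient
is nonzero. -/
def pointSpectrum {n : ℕ} (Λ : Set (EuclideanSpace ℝ (Fin n))) :
    Set (EuclideanSpace ℝ (Fin n)) :=
  {y | ∃ a : ℂ, a ≠ 0 ∧ Filter.Tendsto (ballAverage Λ y) Filter.atTop (nhds a)}

/-- The covering map `ρ_m : ℝᵐ → 𝕋ᵐ`, `x ↦ (e^{2πi x_1}, …, e^{2πi x_m})`. -/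
def torusCover {m : ℕ} (x : EuclideanSpace ℝ (Fin m)) : Fin m → Circle :=
  fun j => Circle.exp (2 * Real.pi * x j)

/-- `(𝕋ᵐ, ψ)` is a toral compactification of `ℝⁿ`: `ψ` is a continuous homomorphism with
dense image. -/
structure IsToralCompactification {n m : ℕ}
    (ψ : EuclideanSpace ℝ (Fin n) → (Fin m → Circle)) : Prop where
  continuous : Continuous ψ
  map_add : ∀ x y, ψ (x + y) = ψ x * ψ y
  dense : DenseRange ψ

/-- The group `Mᵀ ℤᵐ ⊆ ℝⁿ` of frequencies of the toral compactification `ρ_m ∘ M`. -/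
def frequencyGroup {n m : ℕ}
    (M : EuclideanSpace ℝ (Fin n) →ₗ[ℝ] EuclideanSpace ℝ (Fin m)) :
    Set (EuclideanSpace ℝ (Fin n)) :=
  {y | ∃ k : Fin m → ℤ, y = LinearMap.adjoint M (WithLp.toLp 2 fun j => (k j : ℝ))}

end

/-! ### Sets uniformly transverse to a subspace: components as graphs. -/

section TransversalSections

variable {E : Type*} [NormedAddCommGroup E] [InnerProductSpace ℝ E]

/-! Let `X` be the preimage of `K` in `ℝᵐ`. Two uniform properties make the projection of `X` along
`V` onto `Vᗮ` behave like a covering. `X` can be followed along small displacements up to small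
corrections in `V` (`IsFollowedModulo`), and its points on one translate of `V` are uniformly
separated (`IsSeparatedAlong`). Sections then extend from any point of `X` over all of `Vᗮ`,
uniquely, and a connected component is the image of one section.

Both properties come from one fact (`IsBohrAlmostPeriodicSet.almostPeriods_mem_comap`): if `ψ t` is
close to `1`, then `Λ + t` is uniformly close to `Λ`. By density of `ψ`, moving a point of `K` by a
small torus element lands in `K` up to a small element of `ψ(ℝⁿ)`. Conversely, if two points of `X`
differ by `M e` with `e` small, then some `p + e - q` with `p, q ∈ Λ` are arbitrarily good almost
periods, and uniform discreteness forces `e = 0`. The same argument shows that `M` is injective,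
which gives the dimension.

For the fact itself, put `F = μ * f`. Its Fourier coefficients are those of `μ` times those of `f`,
so they vanish off the spectrum. The characters in the spectrum factor through the torus, so they
tend to `1` as `ψ t → 1`. Hence the quadratic mean of `F(· + t) - F` tends to `0`, and
precompactness of the translates of `F` turns this into uniform convergence
(`eventually_norm_translate_sub_lt`). -/

/-- `X` can be followed along every small displacement of the ambient space, up to a small
correction in the direction of `V`. -/
def IsFollowedModulo (X : Set E) (V : Submodule ℝ E) : Prop :=
  ∀ ε : ℝ, 0 < ε → ∃ δ : ℝ, 0 < δ ∧
    ∀ z ∈ X, ∀ w : E, ‖w‖ < δ → ∃ v ∈ V, ‖v‖ < ε ∧ z + w + v ∈ X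

/-- Two points of `X` on the same translate of `V` are equal or at distance at least `r`. -/
def IsSeparatedAlong (X : Set E) (V : Submodule ℝ E) (r : ℝ) : Prop :=
  ∀ z ∈ X, ∀ z' ∈ X, z' - z ∈ V → ‖z' - z‖ < r → z' = z

variable {X : Set E} {V : Submodule ℝ E} {r : ℝ}

/-- The distance between two lifts is `0` or at least `r`, so by the intermediate value theorem it
cannot leave `0` without taking the forbidden value `r / 2`. -/
theorem IsSeparatedAlong.eqOn_of_isPreconnected (hX : IsSeparatedAlong X V r) (hr : 0 < r)
    {T : Type*} [TopologicalSpace T] {D : Set T} (hD : IsPreconnected D) {σ τ : T → E}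
    (hσ : ContinuousOn σ D) (hτ : ContinuousOn τ D) (hσX : ∀ t ∈ D, σ t ∈ X)
    (hτX : ∀ t ∈ D, τ t ∈ X) (hV : ∀ t ∈ D, σ t - τ t ∈ V) {a : T} (ha : a ∈ D)
    (hat : σ a = τ a) : Set.EqOn σ τ D := by
  intro t ht
  by_contra hne
  have hlarge : r ≤ ‖σ t - τ t‖ := by
    by_contra! hlt
    exact hne (hX _ (hτX t ht) _ (hσX t ht) (hV t ht) hlt)
  have hmem : r / 2 ∈ Set.Icc ‖σ a - τ a‖ ‖σ t - τ t‖ := by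
    rw [hat, sub_self, norm_zero]
    constructor <;> linarith
  obtain ⟨b, hb, hbr⟩ := hD.intermediate_value ha ht (hσ.sub hτ).norm hmem
  have hbr' : ‖σ b - τ b‖ = r / 2 := hbr
  have := hX _ (hτX b hb) _ (hσX b hb) (hV b hb) (by rw [hbr']; linarith)
  rw [this, sub_self, norm_zero] at hbr'
  linarith

/-- Corrections `e t` chosen with no regard to continuity are automatically continuous: following
`X` from `g t + e t` reaches a point near `g s + e s` on the same translate of `V`, and separation
identifies the two. -/
theorem IsSeparatedAlong.continuousOn_add (hX : IsSeparatedAlong X V r) (hr : 0 < r)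
    (hf : IsFollowedModulo X V) {T : Type*} [TopologicalSpace T] {D : Set T} {g e : T → E}
    (hg : ContinuousOn g D) (heV : ∀ t ∈ D, e t ∈ V) (he : ∀ t ∈ D, ‖e t‖ < r / 4)
    (hge : ∀ t ∈ D, g t + e t ∈ X) : ContinuousOn (fun t => g t + e t) D := by
  intro t ht
  rw [ContinuousWithinAt, Metric.tendsto_nhds]
  intro η hη
  -- The three vectors `e s`, `e t` and `v` are each shorter than `r / 4`, so their combination
  -- stays below `r`.
  obtain ⟨δ, hδ, hδX⟩ := hf (min (η / 2) (r / 4)) (by positivity)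
  have hnear := Metric.tendsto_nhds.1 (hg t ht) (min δ (η / 2)) (by positivity)
  filter_upwards [hnear, self_mem_nhdsWithin] with s hs hsD
  rw [dist_eq_norm] at hs
  obtain ⟨v, hvV, hv, hvX⟩ := hδX _ (hge t ht) (g s - g t) (hs.trans_le (min_le_left _ _))
  have h1 := hs.trans_le (min_le_right _ _)
  have h2 := hv.trans_le (min_le_left _ _)
  have h3 := hv.trans_le (min_le_right _ _)
  have hdiff : g s + e s - (g t + e t + (g s - g t) + v) = e s - e t - v := by abel
  have heq : g s + e s = g t + e t + (g s - g t) + v := by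
    refine hX _ hvX _ (hge s hsD) ?_ ?_
    · rw [hdiff]
      exact V.sub_mem (V.sub_mem (heV s hsD) (heV t ht)) hvV
    · rw [hdiff]
      have a1 := norm_sub_le (e s - e t) v
      have a2 := norm_sub_le (e s) (e t)
      have a3 := he s hsD
      have a4 := he t ht
      linarith
  rw [heq, dist_eq_norm]
  have : g t + e t + (g s - g t) + v - (g t + e t) = (g s - g t) + v := by abel
  rw [this]
  have := norm_add_le (g s - g t) v
  linarith

/-- A continuous section over the closed ball of radius `R` of `Vᗮ` of the projection of `X`
along `V`, based at `x`. -/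
structure IsSectionOn (X : Set E) (V : Submodule ℝ E) (x : E) (R : ℝ) (σ : Vᗮ → E) : Prop where
  continuousOn : ContinuousOn σ (Metric.closedBall 0 R)
  map_zero : σ 0 = x
  mem : ∀ w ∈ Metric.closedBall (0 : Vᗮ) R, σ w ∈ X
  sub_mem : ∀ w ∈ Metric.closedBall (0 : Vᗮ) R, σ w - (x + w) ∈ V

theorem IsSectionOn.exists_extension (hX : IsSeparatedAlong X V r) (hr : 0 < r)
    (hf : IsFollowedModulo X V) {δ : ℝ} (hδ : 0 < δ)
    (hδX : ∀ z ∈ X, ∀ w : E, ‖w‖ < 2 * δ → ∃ v ∈ V, ‖v‖ < r / 4 ∧ z + w + v ∈ X)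
    {x : E} {R : ℝ} (hR : 0 ≤ R) {σ : Vᗮ → E} (hσ : IsSectionOn X V x R σ) :
    ∃ τ : Vᗮ → E, IsSectionOn X V x (R + δ) τ := by
  -- Scaling by `c` retracts the larger ball onto the smaller one. The rest of the displacement, `(1
  -- - c) • w`, has norm at most `δ`, which `X` can follow in one move.
  set c : ℝ := R / (R + δ) with hc
  have hRδ : 0 < R + δ := by linarith
  have hc0 : 0 ≤ c := by positivity
  have hcw : ∀ w ∈ Metric.closedBall (0 : Vᗮ) (R + δ), c • w ∈ Metric.closedBall (0 : Vᗮ) R := by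
    intro w hw
    rw [mem_closedBall_zero_iff] at hw ⊢
    rw [norm_smul, Real.norm_of_nonneg hc0]
    calc c * ‖w‖ ≤ c * (R + δ) := by gcongr
      _ = R := by rw [hc]; field_simp
  have h1c : 1 - c = δ / (R + δ) := by rw [hc]; field_simp; ring
  have hex : ∀ w : Vᗮ, ∃ v : E, w ∈ Metric.closedBall (0 : Vᗮ) (R + δ) →
      v ∈ V ∧ ‖v‖ < r / 4 ∧ σ (c • w) + (1 - c) • (w : E) + v ∈ X := by
    intro w
    by_cases hw : w ∈ Metric.closedBall (0 : Vᗮ) (R + δ)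
    · have hsmall : ‖(1 - c) • (w : E)‖ < 2 * δ := by
        rw [h1c, norm_smul, Real.norm_of_nonneg (by positivity)]
        rw [mem_closedBall_zero_iff] at hw
        calc δ / (R + δ) * ‖(w : E)‖ ≤ δ / (R + δ) * (R + δ) := by
              gcongr
              exact hw
          _ = δ := by field_simp
          _ < 2 * δ := by linarith
      obtain ⟨v, hv⟩ := hδX _ (hσ.mem _ (hcw w hw)) _ hsmall
      exact ⟨v, fun _ => hv⟩
    · exact ⟨0, fun h => absurd h hw⟩
  choose e he using hex
  have h0 : (0 : Vᗮ) ∈ Metric.closedBall (0 : Vᗮ) R := Metric.mem_closedBall_self hR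
  have h0' : (0 : Vᗮ) ∈ Metric.closedBall (0 : Vᗮ) (R + δ) := Metric.mem_closedBall_self hRδ.le
  refine ⟨fun w => σ (c • w) + (1 - c) • (w : E) + e w, ?_, ?_, fun w hw => (he w hw).2.2, ?_⟩
  · refine hX.continuousOn_add hr hf ?_ (fun w hw => (he w hw).1) (fun w hw => (he w hw).2.1)
      (fun w hw => (he w hw).2.2)
    refine ContinuousOn.add ?_ (by fun_prop)
    exact hσ.continuousOn.comp (by fun_prop) hcw
  · obtain ⟨h1, h2, h3⟩ := he 0 h0'
    simp only [smul_zero, ZeroMemClass.coe_zero, add_zero, hσ.map_zero] at h3 ⊢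
    have hx := hσ.mem 0 h0
    rw [hσ.map_zero] at hx
    refine hX _ hx _ h3 ?_ ?_
    · simpa using h1
    · simp only [add_sub_cancel_left]
      linarith
  · intro w hw
    have h1 := hσ.sub_mem _ (hcw w hw)
    have h2 := V.add_mem h1 (he w hw).1
    convert h2 using 1
    push_cast
    module

theorem exists_isSectionOn_mul (hX : IsSeparatedAlong X V r) (hr : 0 < r)
    (hf : IsFollowedModulo X V) {δ : ℝ} (hδ : 0 < δ)
    (hδX : ∀ z ∈ X, ∀ w : E, ‖w‖ < 2 * δ → ∃ v ∈ V, ‖v‖ < r / 4 ∧ z + w + v ∈ X)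
    {x : E} (hx : x ∈ X) (k : ℕ) : ∃ σ : Vᗮ → E, IsSectionOn X V x (k * δ) σ := by
  induction k with
  | zero =>
    refine ⟨fun _ => x, continuousOn_const, rfl, fun _ _ => hx, fun w hw => ?_⟩
    have : w = 0 := by simpa using hw
    simp [this]
  | succ k ih =>
    obtain ⟨σ, hσ⟩ := ih
    obtain ⟨τ, hτ⟩ := IsSectionOn.exists_extension hX hr hf hδ hδX (by positivity) hσ
    refine ⟨τ, ?_⟩
    have : ((k + 1 : ℕ) : ℝ) * δ = k * δ + δ := by push_cast; ring
    rwa [this]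

theorem IsSectionOn.eq_of_mem (hX : IsSeparatedAlong X V r) (hr : 0 < r) {x : E} {R R' : ℝ}
    {σ τ : Vᗮ → E} (hσ : IsSectionOn X V x R σ) (hτ : IsSectionOn X V x R' τ) {w : Vᗮ}
    (hw : w ∈ Metric.closedBall (0 : Vᗮ) R) (hw' : w ∈ Metric.closedBall (0 : Vᗮ) R') :
    σ w = τ w := by
  rw [mem_closedBall_zero_iff] at hw hw'
  have h1 : Metric.closedBall (0 : Vᗮ) ‖w‖ ⊆ Metric.closedBall (0 : Vᗮ) R :=
    Metric.closedBall_subset_closedBall hw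
  have h2 : Metric.closedBall (0 : Vᗮ) ‖w‖ ⊆ Metric.closedBall (0 : Vᗮ) R' :=
    Metric.closedBall_subset_closedBall hw'
  refine hX.eqOn_of_isPreconnected hr (convex_closedBall (0 : Vᗮ) ‖w‖).isPreconnected
    (hσ.continuousOn.mono h1) (hτ.continuousOn.mono h2) (fun t ht => hσ.mem t (h1 ht))
    (fun t ht => hτ.mem t (h2 ht)) (fun t ht => ?_)
    (Metric.mem_closedBall_self (norm_nonneg w)) (hσ.map_zero.trans hτ.map_zero.symm) (by simp)
  have := V.sub_mem (hσ.sub_mem t (h1 ht)) (hτ.sub_mem t (h2 ht))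
  convert this using 1
  abel

theorem exists_continuous_section (hX : IsSeparatedAlong X V r) (hr : 0 < r)
    (hf : IsFollowedModulo X V) {x : E} (hx : x ∈ X) :
    ∃ σ : Vᗮ → E, Continuous σ ∧ σ 0 = x ∧ (∀ w, σ w ∈ X) ∧ ∀ w, σ w - (x + w) ∈ V := by
  obtain ⟨δ₂, hδ₂, hδX⟩ := hf (r / 4) (by linarith)
  -- Halving leaves room for displacements of norm exactly `δ` on closed balls. As `δ` serves every
  -- point of `X`, each extension gains the same radius and all of `Vᗮ` is exhausted.
  obtain ⟨δ, rfl⟩ : ∃ δ, δ₂ = 2 * δ := ⟨δ₂ / 2, by ring⟩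
  have hδ : 0 < δ := by linarith
  choose σ hσ using exists_isSectionOn_mul hX hr hf hδ hδX hx
  have hmem : ∀ w : Vᗮ, w ∈ Metric.closedBall (0 : Vᗮ) (⌈‖w‖ / δ⌉₊ * δ) := by
    intro w
    rw [mem_closedBall_zero_iff, ← div_le_iff₀ hδ]
    exact Nat.le_ceil _
  have hglue : ∀ k : ℕ, ∀ w ∈ Metric.closedBall (0 : Vᗮ) (k * δ), σ ⌈‖w‖ / δ⌉₊ w = σ k w :=
    fun k w hw => (hσ _).eq_of_mem hX hr (hσ k) (hmem w) hw
  refine ⟨fun w => σ ⌈‖w‖ / δ⌉₊ w, ?_, (hσ _).map_zero, fun w => (hσ _).mem _ (hmem w),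
    fun w => (hσ _).sub_mem _ (hmem w)⟩
  rw [continuous_iff_continuousAt]
  intro w
  obtain ⟨k, hk⟩ := exists_nat_gt (‖w‖ / δ)
  rw [div_lt_iff₀ hδ] at hk
  have hnhds : Metric.closedBall (0 : Vᗮ) (k * δ) ∈ nhds w :=
    Filter.mem_of_superset (Metric.isOpen_ball.mem_nhds (by simpa using hk))
      Metric.ball_subset_closedBall
  refine ((hσ k).continuousOn.continuousAt hnhds).congr ?_
  filter_upwards [hnhds] with w' hw'
  exact (hglue k w' hw').symm

/-- The connected components of `X` are graphs of continuous functions `Vᗮ → V`. -/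
theorem exists_homeomorph_connectedComponentIn [V.HasOrthogonalProjection]
    (hX : IsSeparatedAlong X V r) (hr : 0 < r) (hf : IsFollowedModulo X V) {x : E} (hx : x ∈ X) :
    ∃ h : Vᗮ → V, Continuous h ∧ ∃ e : Vᗮ ≃ₜ connectedComponentIn X x,
      ∀ u : Vᗮ, (e u : E) = (h u : E) + (u : E) := by
  obtain ⟨σ, hσ, hσ0, hσX, hσV⟩ := exists_continuous_section hX hr hf hx
  set p : E → Vᗮ := Vᗮ.orthogonalProjectionOnto with hp
  have hpc : Continuous p := Vᗮ.orthogonalProjectionOnto.continuous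
  have hpsub : ∀ z, z - (p z : E) ∈ V := by
    intro z
    have := Submodule.sub_starProjection_mem_orthogonal (K := Vᗮ) z
    rwa [Submodule.orthogonal_orthogonal] at this
  have hpV : ∀ z : E, ∀ w : Vᗮ, z - (w : E) ∈ V → p z = w := by
    intro z w hzw
    have : (p z : E) - w ∈ V ⊓ Vᗮ := by
      refine ⟨?_, Vᗮ.sub_mem (p z).2 w.2⟩
      have := V.sub_mem hzw (hpsub z)
      rwa [sub_sub_sub_cancel_left] at this
    rw [V.inf_orthogonal_eq_bot, Submodule.mem_bot, sub_eq_zero] at this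
    exact Subtype.ext this
  -- `σ` is parametrised by the displacement from `x`; the shift by `p x` makes `s` a section of
  -- `p`.
  set s : Vᗮ → E := fun u => σ (u - p x) with hs
  have hsc : Continuous s := by fun_prop
  have hsV : ∀ u : Vᗮ, s u - u ∈ V := by
    intro u
    have := V.add_mem (hσV (u - p x)) (hpsub x)
    convert this using 1
    push_cast
    simp only [hs]
    abel
  have hsx : s (p x) = x := by simp [hs, hσ0]
  have hps : ∀ u, p (s u) = u := fun u => hpV _ _ (hsV u)
  have hrange : Set.range s ⊆ connectedComponentIn X x := by
    refine (isPreconnected_range hsc).subset_connectedComponentIn ⟨p x, hsx⟩ ?_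
    rintro _ ⟨u, rfl⟩
    exact hσX _
  -- On the component, the identity and `s ∘ p` are two lifts of `p` that agree at `x`.
  have hcomp : ∀ z ∈ connectedComponentIn X x, z = s (p z) := by
    refine hX.eqOn_of_isPreconnected hr isPreconnected_connectedComponentIn continuousOn_id
      (hsc.comp hpc).continuousOn (fun t ht => connectedComponentIn_subset X x ht)
      (fun t _ => hσX _) (fun t _ => ?_) (mem_connectedComponentIn hx) hsx.symm
    have := V.sub_mem (hpsub t) (hsV (p t))
    convert this using 1
    simp
  refine ⟨fun u => ⟨s u - u, hsV u⟩, by fun_prop,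
    { toFun := fun u => ⟨s u, hrange ⟨u, rfl⟩⟩
      invFun := fun z => p z
      left_inv := hps
      right_inv := fun z => Subtype.ext (hcomp z z.2).symm
      continuous_toFun := by fun_prop
      continuous_invFun := hpc.comp continuous_subtype_val }, fun u => ?_⟩
  change s u = s u - u + u
  abel

end TransversalSections

/-! ### Means over large balls and their translation invariance. -/

section BallMeans

open MeasureTheory Filter Topology Metric

variable {E : Type*} [NormedAddCommGroup E] [InnerProductSpace ℝ E] [FiniteDimensional ℝ E]
  [MeasurableSpace E] [BorelSpace E]

theorem tendsto_volume_ball_add_div (c : ℝ) :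
    Tendsto (fun R : ℝ => volume.real (ball (0 : E) (R + c)) / volume.real (ball (0 : E) R))
      atTop (𝓝 1) := by
  have hpos : ∀ R : ℝ, 0 < R → volume.real (ball (0 : E) R)
      = R ^ Module.finrank ℝ E * volume.real (ball (0 : E) 1) := by
    intro R hR
    rw [measureReal_def, Measure.addHaar_ball_of_pos _ _ hR, ENNReal.toReal_mul,
      ENNReal.toReal_ofReal (by positivity), measureReal_def]
  have h1 : volume.real (ball (0 : E) 1) ≠ 0 :=
    (ENNReal.toReal_pos (measure_ball_pos _ _ one_pos).ne' measure_ball_lt_top.ne).ne'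
  have hlim : Tendsto (fun R : ℝ => (1 + c / R) ^ Module.finrank ℝ E) atTop (𝓝 1) := by
    have : Tendsto (fun R : ℝ => c / R) atTop (𝓝 0) := tendsto_const_nhds.div_atTop tendsto_id
    simpa using ((this.const_add 1).pow (Module.finrank ℝ E))
  refine hlim.congr' ?_
  filter_upwards [eventually_gt_atTop 0, eventually_gt_atTop (-c)] with R hR hRc
  rw [hpos R hR, hpos (R + c) (by linarith), mul_div_mul_right _ _ h1, ← div_pow]
  congr 1
  field_simp

theorem tendsto_volume_annulus_div (a b : ℝ) :
    Tendsto (fun R : ℝ => (volume.real (ball (0 : E) (R + a)) - volume.real (ball (0 : E) (R + b)))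
      / volume.real (ball (0 : E) R)) atTop (𝓝 0) := by
  simpa [sub_div] using
    (tendsto_volume_ball_add_div (E := E) a).sub (tendsto_volume_ball_add_div (E := E) b)

theorem volume_real_ball_pos (x : E) {R : ℝ} (hR : 0 < R) : 0 < volume.real (ball x R) :=
  ENNReal.toReal_pos (measure_ball_pos _ _ hR).ne' measure_ball_lt_top.ne

/-- The mean of `F` over the ball of radius `R` around the origin. -/
noncomputable def ballMean (F : E → ℂ) (R : ℝ) : ℂ := ⨍ x in ball (0 : E) R, F x

theorem ballMean_eq (F : E → ℂ) (R : ℝ) :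
    ballMean F R = (volume.real (ball (0 : E) R))⁻¹ • ∫ x in ball (0 : E) R, F x := by
  rw [ballMean, setAverage_eq]

/-- The means of `F` over large balls converge to `a`. -/
def HasMean (F : E → ℂ) (a : ℂ) : Prop := Tendsto (ballMean F) atTop (𝓝 a)

theorem Continuous.integrableOn_metric_ball {F : E → ℂ} (hF : Continuous F) (x : E) (R : ℝ) :
    IntegrableOn F (ball x R) :=
  (hF.continuousOn.integrableOn_compact (isCompact_closedBall x R)).mono_set ball_subset_closedBall

theorem ballMean_add {F G : E → ℂ} (hF : Continuous F) (hG : Continuous G) (R : ℝ) :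
    ballMean (fun x => F x + G x) R = ballMean F R + ballMean G R := by
  simp only [ballMean_eq]
  rw [integral_add (hF.integrableOn_metric_ball 0 R) (hG.integrableOn_metric_ball 0 R), smul_add]

theorem ballMean_sub {F G : E → ℂ} (hF : Continuous F) (hG : Continuous G) (R : ℝ) :
    ballMean (fun x => F x - G x) R = ballMean F R - ballMean G R := by
  simp only [ballMean_eq]
  rw [integral_sub (hF.integrableOn_metric_ball 0 R) (hG.integrableOn_metric_ball 0 R), smul_sub]

theorem ballMean_const_mul (c : ℂ) (F : E → ℂ) (R : ℝ) :
    ballMean (fun x => c * F x) R = c * ballMean F R := by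
  simp only [ballMean_eq]
  rw [integral_const_mul, mul_smul_comm]

theorem ballMean_const (c : ℂ) {R : ℝ} (hR : 0 < R) : ballMean (fun _ : E => c) R = c := by
  rw [ballMean, setAverage_const (measure_ball_pos _ _ hR).ne' measure_ball_lt_top.ne]

theorem norm_ballMean_le {F : E → ℂ} {C : ℝ} (hC : ∀ x, ‖F x‖ ≤ C) (R : ℝ) :
    ‖ballMean F R‖ ≤ C := by
  have hC0 : 0 ≤ C := (norm_nonneg _).trans (hC 0)
  rw [ballMean_eq, norm_smul, norm_inv, Real.norm_of_nonneg measureReal_nonneg]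
  have h := norm_setIntegral_le_of_norm_le_const (f := F) (s := ball (0 : E) R) (μ := volume)
    measure_ball_lt_top (fun x _ => hC x)
  rcases eq_or_ne (volume.real (ball (0 : E) R)) 0 with h0 | h0
  · rw [h0]; simpa using hC0
  · rw [inv_mul_le_iff₀ (lt_of_le_of_ne measureReal_nonneg h0.symm), mul_comm]
    exact h

theorem le_re_ballMean {F : E → ℂ} (hF : Continuous F) {c : ℝ} (hc : ∀ x, c ≤ (F x).re) {R : ℝ}
    (hR : 0 < R) : c ≤ (ballMean F R).re := by
  have hV := volume_real_ball_pos (0 : E) hR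
  have hint := hF.integrableOn_metric_ball 0 R
  have hre : (∫ x in ball (0 : E) R, F x).re = ∫ x in ball (0 : E) R, (F x).re :=
    (Complex.reCLM.integral_comp_comm hint).symm
  rw [ballMean_eq, Complex.smul_re, hre, smul_eq_mul, ← div_eq_inv_mul, le_div_iff₀ hV]
  have : c * volume.real (ball (0 : E) R) = ∫ x in ball (0 : E) R, c := by
    rw [setIntegral_const, smul_eq_mul, mul_comm]
  rw [this]
  refine integral_mono ?_ (Complex.reCLM.integrable_comp hint) hc
  exact integrableOn_const measure_ball_lt_top.ne

theorem tendsto_ballMean_translate_sub {F : E → ℂ} (hF : Continuous F) {C : ℝ}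
    (hC : ∀ x, ‖F x‖ ≤ C) (t : E) :
    Tendsto (fun R => ballMean (fun x => F (x + t)) R - ballMean F R) atTop (𝓝 0) := by
  have hlim := (tendsto_volume_annulus_div (E := E) 0 (-‖t‖)).const_mul (2 * C)
  rw [mul_zero] at hlim
  refine squeeze_zero_norm' ?_ hlim
  filter_upwards [eventually_gt_atTop 0] with R hR
  have hV := volume_real_ball_pos (0 : E) hR
  have htrans : ∫ x in ball (0 : E) R, F (x + t) = ∫ x in ball t R, F x := by
    have := (measurePreserving_add_right (volume : Measure E) t).setIntegral_preimage_emb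
      (measurableEmbedding_addRight t) F (ball t R)
    rw [← this, preimage_add_right_ball, sub_self]
  -- Both `ball t R` and `ball 0 R` contain `ball 0 (R - ‖t‖)`; what each has beyond it has
  -- negligible relative volume.
  have key : ∀ y : E, ball (0 : E) (R + -‖t‖) ⊆ ball y R →
      ‖(∫ x in ball y R, F x) - ∫ x in ball (0 : E) (R + -‖t‖), F x‖ ≤
        C * (volume.real (ball (0 : E) (R + 0)) - volume.real (ball (0 : E) (R + -‖t‖))) := by
    intro y hy
    rw [← setIntegral_sdiff measurableSet_ball (hF.integrableOn_metric_ball y R) hy]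
    have h := norm_setIntegral_le_of_norm_le_const (f := F) (s := ball y R \ ball 0 (R + -‖t‖))
      (μ := volume) ((measure_mono Set.sdiff_subset).trans_lt measure_ball_lt_top) (fun x _ => hC x)
    rw [measureReal_sdiff hy measurableSet_ball measure_ball_lt_top.ne] at h
    rw [add_zero]
    have hy : volume.real (ball (0 : E) R) = volume.real (ball y R) := by
      rw [measureReal_def, measureReal_def, Measure.addHaar_ball_center _ y]
    rwa [hy]
  have h1 := key t (ball_subset_ball' (by rw [dist_zero_left]; linarith))
  have h2 := key 0 (ball_subset_ball (by linarith [norm_nonneg t]))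
  rw [ballMean_eq, ballMean_eq, htrans, ← smul_sub, norm_smul, norm_inv,
    Real.norm_of_nonneg measureReal_nonneg, ← div_eq_inv_mul, ← mul_div_assoc]
  gcongr
  have h3 := norm_sub_le ((∫ x in ball t R, F x) - ∫ x in ball (0 : E) (R + -‖t‖), F x)
    ((∫ x in ball 0 R, F x) - ∫ x in ball (0 : E) (R + -‖t‖), F x)
  rw [sub_sub_sub_cancel_right] at h3
  linarith

theorem HasMean.translate {F : E → ℂ} {a : ℂ} (h : HasMean F a) (hF : Continuous F) {C : ℝ}
    (hC : ∀ x, ‖F x‖ ≤ C) (t : E) : HasMean (fun x => F (x + t)) a := by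
  have := (tendsto_ballMean_translate_sub hF hC t).add h
  simpa [HasMean] using this

theorem HasMean.unique {F : E → ℂ} {a b : ℂ} (ha : HasMean F a) (hb : HasMean F b) : a = b :=
  tendsto_nhds_unique ha hb

theorem HasMean.add {F G : E → ℂ} {a b : ℂ} (ha : HasMean F a) (hb : HasMean G b)
    (hF : Continuous F) (hG : Continuous G) : HasMean (fun x => F x + G x) (a + b) :=
  (Tendsto.add ha hb).congr fun R => (ballMean_add hF hG R).symm

theorem HasMean.sub {F G : E → ℂ} {a b : ℂ} (ha : HasMean F a) (hb : HasMean G b)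
    (hF : Continuous F) (hG : Continuous G) : HasMean (fun x => F x - G x) (a - b) :=
  (Tendsto.sub ha hb).congr fun R => (ballMean_sub hF hG R).symm

theorem HasMean.const_mul {F : E → ℂ} {a : ℂ} (c : ℂ) (ha : HasMean F a) :
    HasMean (fun x => c * F x) (c * a) :=
  (Tendsto.const_mul c ha).congr fun R => (ballMean_const_mul c F R).symm

theorem hasMean_const (c : ℂ) : HasMean (fun _ : E => c) c :=
  (tendsto_const_nhds).congr' (by
    filter_upwards [eventually_gt_atTop 0] with R hR using (ballMean_const c hR).symm)

theorem HasMean.norm_le {F : E → ℂ} {a : ℂ} (ha : HasMean F a) {C : ℝ} (hC : ∀ x, ‖F x‖ ≤ C) :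
    ‖a‖ ≤ C :=
  le_of_tendsto (Tendsto.norm ha) (Eventually.of_forall (norm_ballMean_le hC))

theorem HasMean.sum {ι : Type*} (s : Finset ι) {F : ι → E → ℂ} {a : ι → ℂ}
    (ha : ∀ i ∈ s, HasMean (F i) (a i)) (hF : ∀ i ∈ s, Continuous (F i)) :
    HasMean (fun x => ∑ i ∈ s, F i x) (∑ i ∈ s, a i) := by
  classical
  induction s using Finset.induction_on with
  | empty => simpa using hasMean_const (E := E) 0
  | insert i s hi ih =>
    simp only [Finset.sum_insert hi]
    refine (ha i (by simp)).add (ih (fun j hj => ha j (by simp [hj]))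
      fun j hj => hF j (by simp [hj])) (hF i (by simp)) ?_
    exact continuous_finsetSum s fun j hj => hF j (by simp [hj])

theorem HasMean.le_re {F : E → ℂ} {a : ℂ} (ha : HasMean F a) (hF : Continuous F) {c : ℝ}
    (hc : ∀ x, c ≤ (F x).re) : c ≤ a.re :=
  ge_of_tendsto ((Complex.continuous_re.tendsto a).comp ha) (by
    filter_upwards [eventually_gt_atTop 0] with R hR using le_re_ballMean hF hc hR)

/-- A uniform limit of functions which have a mean has a mean. -/
theorem exists_hasMean_of_approx {F : E → ℂ} (hF : Continuous F)
    (h : ∀ ε : ℝ, 0 < ε → ∃ P : E → ℂ, Continuous P ∧ (∃ a, HasMean P a) ∧ ∀ x, ‖F x - P x‖ ≤ ε) :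
    ∃ a, HasMean F a := by
  refine cauchySeq_tendsto_of_complete (Metric.cauchySeq_iff.2 fun ε hε => ?_)
  obtain ⟨P, hP, ⟨a, ha⟩, hFP⟩ := h (ε / 4) (by positivity)
  obtain ⟨N, hN⟩ := Metric.cauchySeq_iff.1 ha.cauchySeq (ε / 4) (by positivity)
  refine ⟨N, fun R hR R' hR' => ?_⟩
  have h1 := norm_ballMean_le hFP R
  have h2 := norm_ballMean_le hFP R'
  rw [ballMean_sub hF hP] at h1 h2
  have h3 := hN R hR R' hR'
  rw [dist_eq_norm] at h3 ⊢
  have : ballMean F R - ballMean F R' = (ballMean F R - ballMean P R)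
      + (ballMean P R - ballMean P R') - (ballMean F R' - ballMean P R') := by ring
  rw [this]
  have h4 := norm_sub_le (ballMean F R - ballMean P R + (ballMean P R - ballMean P R'))
    (ballMean F R' - ballMean P R')
  have h5 := norm_add_le (ballMean F R - ballMean P R) (ballMean P R - ballMean P R')
  linarith

end BallMeans

/-! ### Trigonometric polynomials and Bohr almost periodic functions. -/

section AlmostPeriodicFunctions

open MeasureTheory Filter Topology Metric

variable {n : ℕ}

theorem character_add_right (y x t : EuclideanSpace ℝ (Fin n)) :
    character y (x + t) = character y x * character y t := by
  rw [character, character, character, ← Complex.exp_add, inner_add_right]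
  push_cast
  ring_nf

theorem character_add_left (y z x : EuclideanSpace ℝ (Fin n)) :
    character (y + z) x = character y x * character z x := by
  rw [character, character, character, ← Complex.exp_add, inner_add_left]
  push_cast
  ring_nf

theorem norm_character (y x : EuclideanSpace ℝ (Fin n)) : ‖character y x‖ = 1 := by
  rw [character, Complex.norm_exp]
  simp

theorem star_character (y x : EuclideanSpace ℝ (Fin n)) :
    (starRingEnd ℂ) (character y x) = character (-y) x := by
  rw [character, character, ← Complex.exp_conj, inner_neg_left]
  simp [Complex.conj_ofNat]

theorem character_zero_left (x : EuclideanSpace ℝ (Fin n)) : character 0 x = 1 := by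
  simp [character]

theorem character_mul_neg (y x : EuclideanSpace ℝ (Fin n)) :
    character y x * character (-y) x = 1 := by
  rw [← character_add_left, add_neg_cancel, character_zero_left]

theorem continuous_character (y : EuclideanSpace ℝ (Fin n)) : Continuous (character y) := by
  unfold character
  fun_prop

theorem exists_character_ne_one {y : EuclideanSpace ℝ (Fin n)} (hy : y ≠ 0) :
    ∃ t, character y t ≠ 1 := by
  refine ⟨(1 / (2 * ‖y‖ ^ 2)) • y, ?_⟩
  have hy' : ‖y‖ ≠ 0 := norm_ne_zero_iff.2 hy
  have : character y ((1 / (2 * ‖y‖ ^ 2)) • y) = Complex.exp (Real.pi * Complex.I) := by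
    rw [character, real_inner_smul_right, real_inner_self_eq_norm_sq]
    congr 1
    have : 1 / (2 * ‖y‖ ^ 2) * ‖y‖ ^ 2 = 1 / 2 := by field_simp
    rw [this]
    push_cast
    ring
  rw [this, Complex.exp_pi_mul_I]
  norm_num

/-- For `y ≠ 0` a translation multiplies the character by a constant other than `1`, while its means
are asymptotically translation invariant; so they tend to `0`. -/
theorem exists_hasMean_character (y : EuclideanSpace ℝ (Fin n)) : ∃ a, HasMean (character y) a := by
  rcases eq_or_ne y 0 with rfl | hy
  · refine ⟨1, ?_⟩
    have : character (0 : EuclideanSpace ℝ (Fin n)) = fun _ => 1 := funext character_zero_left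
    rw [this]
    exact hasMean_const 1
  · obtain ⟨t, ht⟩ := exists_character_ne_one hy
    refine ⟨0, ?_⟩
    have h := tendsto_ballMean_translate_sub (continuous_character y)
      (fun x => (norm_character y x).le) t
    have hsub : ∀ R, ballMean (fun x => character y (x + t)) R - ballMean (character y) R
        = (character y t - 1) * ballMean (character y) R := by
      intro R
      simp only [character_add_right, mul_comm _ (character y t)]
      rw [ballMean_const_mul]
      ring
    simp only [hsub] at h
    have h2 := h.const_mul (character y t - 1)⁻¹
    simpa [HasMean, ← mul_assoc, inv_mul_cancel₀ (sub_ne_zero.2 ht)] using h2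

/-- The space of trigonometric polynomials. -/
abbrev trigPolynomials (n : ℕ) : Submodule ℂ (EuclideanSpace ℝ (Fin n) → ℂ) :=
  Submodule.span ℂ (Set.range (character (n := n)))

theorem character_mem_trigPolynomials (y : EuclideanSpace ℝ (Fin n)) :
    character y ∈ trigPolynomials n := Submodule.subset_span ⟨y, rfl⟩

theorem trigPolynomials.induction
    {p : (P : EuclideanSpace ℝ (Fin n) → ℂ) → P ∈ trigPolynomials n → Prop}
    (char : ∀ y, p (character y) (character_mem_trigPolynomials y))
    (zero : p (fun _ => 0) (Submodule.zero_mem _))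
    (add : ∀ P hP Q hQ, p P hP → p Q hQ → p (fun x => P x + Q x) (Submodule.add_mem _ hP hQ))
    (mul : ∀ (c : ℂ) P hP, p P hP → p (fun x => c * P x) (Submodule.smul_mem _ c hP))
    {P : EuclideanSpace ℝ (Fin n) → ℂ} (hP : P ∈ trigPolynomials n) : p P hP := by
  induction hP using Submodule.span_induction with
  | mem x hx => obtain ⟨y, rfl⟩ := hx; exact char y
  | zero => exact zero
  | add x y hx hy h1 h2 => exact add x hx y hy h1 h2
  | smul c x hx h => exact mul c x hx h

theorem continuous_of_mem_trigPolynomials {P : EuclideanSpace ℝ (Fin n) → ℂ}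
    (hP : P ∈ trigPolynomials n) : Continuous P := by
  induction hP using trigPolynomials.induction with
  | char y => exact continuous_character y
  | zero => exact continuous_const
  | add P _ Q _ h1 h2 => exact h1.add h2
  | mul c P _ h => exact continuous_const.mul h

theorem bounded_of_mem_trigPolynomials {P : EuclideanSpace ℝ (Fin n) → ℂ}
    (hP : P ∈ trigPolynomials n) : ∃ C, ∀ x, ‖P x‖ ≤ C := by
  induction hP using trigPolynomials.induction with
  | char y => exact ⟨1, fun x => (norm_character y x).le⟩
  | zero => exact ⟨0, fun x => by simp⟩
  | add P _ Q _ h1 h2 =>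
    obtain ⟨C, hC⟩ := h1
    obtain ⟨D, hD⟩ := h2
    exact ⟨C + D, fun x => (norm_add_le _ _).trans (add_le_add (hC x) (hD x))⟩
  | mul c P _ h =>
    obtain ⟨C, hC⟩ := h
    refine ⟨‖c‖ * C, fun x => ?_⟩
    rw [norm_mul]
    gcongr
    exact hC x

theorem exists_hasMean_of_mem_trigPolynomials {P : EuclideanSpace ℝ (Fin n) → ℂ}
    (hP : P ∈ trigPolynomials n) : ∃ a, HasMean P a := by
  induction hP using trigPolynomials.induction with
  | char y => exact exists_hasMean_character y
  | zero => exact ⟨0, hasMean_const 0⟩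
  | add P hP Q hQ h1 h2 =>
    obtain ⟨a, ha⟩ := h1
    obtain ⟨b, hb⟩ := h2
    exact ⟨a + b, ha.add hb (continuous_of_mem_trigPolynomials hP)
      (continuous_of_mem_trigPolynomials hQ)⟩
  | mul c P _ h =>
    obtain ⟨a, ha⟩ := h
    exact ⟨c * a, ha.const_mul c⟩

theorem mul_mem_trigPolynomials {P Q : EuclideanSpace ℝ (Fin n) → ℂ}
    (hP : P ∈ trigPolynomials n) (hQ : Q ∈ trigPolynomials n) :
    (fun x => P x * Q x) ∈ trigPolynomials n := by
  have h := Submodule.mul_mem_mul hP hQ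
  rw [Submodule.span_mul_span] at h
  refine Submodule.span_mono ?_ h
  rintro _ ⟨_, ⟨y, rfl⟩, _, ⟨z, rfl⟩, rfl⟩
  exact ⟨y + z, funext fun x => character_add_left y z x⟩

theorem star_mem_trigPolynomials {P : EuclideanSpace ℝ (Fin n) → ℂ}
    (hP : P ∈ trigPolynomials n) : (fun x => (starRingEnd ℂ) (P x)) ∈ trigPolynomials n := by
  induction hP using trigPolynomials.induction with
  | char y =>
    simp only [star_character]
    exact character_mem_trigPolynomials (-y)
  | zero =>
    simp only [map_zero]
    exact (trigPolynomials n).zero_mem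
  | add P _ Q _ h1 h2 =>
    simp only [map_add]
    exact (trigPolynomials n).add_mem h1 h2
  | mul c P _ h =>
    simp only [map_mul]
    exact (trigPolynomials n).smul_mem _ h

theorem translate_mem_trigPolynomials {P : EuclideanSpace ℝ (Fin n) → ℂ}
    (hP : P ∈ trigPolynomials n) (t : EuclideanSpace ℝ (Fin n)) :
    (fun x => P (x + t)) ∈ trigPolynomials n := by
  induction hP using trigPolynomials.induction with
  | char y =>
    simp only [character_add_right, mul_comm _ (character y t)]
    exact (trigPolynomials n).smul_mem _ (character_mem_trigPolynomials y)
  | zero => exact (trigPolynomials n).zero_mem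
  | add P _ Q _ h1 h2 => exact (trigPolynomials n).add_mem h1 h2
  | mul c P _ h => exact (trigPolynomials n).smul_mem _ h

/-- The translates of `F` form a totally bounded family for the uniform distance. -/
def HasPrecompactTranslates (F : EuclideanSpace ℝ (Fin n) → ℂ) : Prop :=
  ∀ ε : ℝ, 0 < ε → ∃ (ι : Type) (_ : Finite ι) (c : EuclideanSpace ℝ (Fin n) → ι),
    ∀ s t, c s = c t → ∀ x, ‖F (x + s) - F (x + t)‖ ≤ ε

theorem hasPrecompactTranslates_character (y : EuclideanSpace ℝ (Fin n)) :
    HasPrecompactTranslates (character y) := by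
  intro ε hε
  obtain ⟨T, -, hTfin, hT⟩ := finite_cover_balls_of_compact
    (isCompact_closedBall (0 : ℂ) 1) (e := ε / 2) (by positivity)
  have hmem : ∀ s, ∃ z : T, dist (character y s) z < ε / 2 := by
    intro s
    have : character y s ∈ closedBall (0 : ℂ) 1 := by simp [norm_character]
    have := hT this
    simp only [Set.mem_iUnion] at this
    obtain ⟨z, hz, h⟩ := this
    exact ⟨⟨z, hz⟩, h⟩
  choose c hc using hmem
  have : Finite T := hTfin
  obtain ⟨k, ⟨g⟩⟩ := Finite.exists_equiv_fin T
  refine ⟨Fin k, inferInstance, fun s => g (c s), fun s t hst x => ?_⟩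
  have hst' : c s = c t := g.injective hst
  have h1 := hc s
  have h2 := hc t
  rw [hst'] at h1
  rw [character_add_right, character_add_right, ← mul_sub, norm_mul, norm_character, one_mul,
    ← dist_eq_norm]
  have := dist_triangle_right (character y s) (character y t) (c t)
  linarith

theorem HasPrecompactTranslates.add {F G : EuclideanSpace ℝ (Fin n) → ℂ}
    (hF : HasPrecompactTranslates F) (hG : HasPrecompactTranslates G) :
    HasPrecompactTranslates fun x => F x + G x := by
  intro ε hε
  obtain ⟨ι, _, c, hc⟩ := hF (ε / 2) (by positivity)
  obtain ⟨κ, _, d, hd⟩ := hG (ε / 2) (by positivity)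
  refine ⟨ι × κ, inferInstance, fun s => (c s, d s), fun s t hst x => ?_⟩
  obtain ⟨h1, h2⟩ := Prod.mk.inj hst
  rw [add_sub_add_comm]
  have a1 := norm_add_le (F (x + s) - F (x + t)) (G (x + s) - G (x + t))
  have a2 := hc s t h1 x
  have a3 := hd s t h2 x
  linarith

theorem HasPrecompactTranslates.const_mul {F : EuclideanSpace ℝ (Fin n) → ℂ}
    (hF : HasPrecompactTranslates F) (a : ℂ) : HasPrecompactTranslates fun x => a * F x := by
  intro ε hε
  obtain ⟨ι, hι, c, hc⟩ := hF (ε / (‖a‖ + 1)) (by positivity)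
  refine ⟨ι, hι, c, fun s t hst x => ?_⟩
  rw [← mul_sub, norm_mul]
  calc ‖a‖ * ‖F (x + s) - F (x + t)‖ ≤ (‖a‖ + 1) * (ε / (‖a‖ + 1)) := by
        gcongr
        · linarith
        · exact hc s t hst x
    _ = ε := by field_simp

theorem hasPrecompactTranslates_of_mem_trigPolynomials {P : EuclideanSpace ℝ (Fin n) → ℂ}
    (hP : P ∈ trigPolynomials n) : HasPrecompactTranslates P := by
  induction hP using trigPolynomials.induction with
  | char y => exact hasPrecompactTranslates_character y
  | zero => exact fun ε hε => ⟨Unit, inferInstance, fun _ => (), fun s t _ x => by simpa using hε.le⟩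
  | add P _ Q _ h1 h2 => exact h1.add h2
  | mul c P _ h => exact h.const_mul c

namespace IsBohrAlmostPeriodicFun

variable {F G : EuclideanSpace ℝ (Fin n) → ℂ}

theorem of_mem_trigPolynomials (hF : F ∈ trigPolynomials n) : IsBohrAlmostPeriodicFun F :=
  fun ε hε => ⟨F, hF, fun x => by simpa using hε⟩

theorem continuous (hF : IsBohrAlmostPeriodicFun F) : Continuous F := by
  refine continuous_of_uniform_approx_of_continuous fun u hu => ?_
  obtain ⟨ε, hε, hu⟩ := Metric.mem_uniformity_dist.1 hu
  obtain ⟨P, hP, h⟩ := hF ε hε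
  exact ⟨P, continuous_of_mem_trigPolynomials hP, fun x => hu (by rw [dist_eq_norm]; exact h x)⟩

theorem bounded (hF : IsBohrAlmostPeriodicFun F) : ∃ C, 0 ≤ C ∧ ∀ x, ‖F x‖ ≤ C := by
  obtain ⟨P, hP, h⟩ := hF 1 one_pos
  obtain ⟨C, hC⟩ := bounded_of_mem_trigPolynomials hP
  refine ⟨C + 1, by linarith [(norm_nonneg _).trans (hC 0)], fun x => ?_⟩
  have := norm_le_norm_add_norm_sub' (F x) (P x)
  linarith [hC x, h x]

theorem exists_hasMean (hF : IsBohrAlmostPeriodicFun F) : ∃ a, HasMean F a :=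
  exists_hasMean_of_approx hF.continuous fun ε hε => by
    obtain ⟨P, hP, h⟩ := hF ε hε
    exact ⟨P, continuous_of_mem_trigPolynomials hP, exists_hasMean_of_mem_trigPolynomials hP,
      fun x => (h x).le⟩

theorem hasPrecompactTranslates (hF : IsBohrAlmostPeriodicFun F) : HasPrecompactTranslates F := by
  intro ε hε
  obtain ⟨P, hP, h⟩ := hF (ε / 3) (by positivity)
  obtain ⟨ι, hι, c, hc⟩ := hasPrecompactTranslates_of_mem_trigPolynomials hP (ε / 3) (by positivity)
  refine ⟨ι, hι, c, fun s t hst x => ?_⟩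
  have h1 := h (x + s)
  have h2 := h (x + t)
  have h3 := hc s t hst x
  have : F (x + s) - F (x + t) = (F (x + s) - P (x + s)) + (P (x + s) - P (x + t))
      - (F (x + t) - P (x + t)) := by ring
  rw [this]
  have h4 := norm_sub_le ((F (x + s) - P (x + s)) + (P (x + s) - P (x + t)))
    (F (x + t) - P (x + t))
  have h5 := norm_add_le (F (x + s) - P (x + s)) (P (x + s) - P (x + t))
  linarith

theorem sub (hF : IsBohrAlmostPeriodicFun F) (hG : IsBohrAlmostPeriodicFun G) :
    IsBohrAlmostPeriodicFun fun x => F x - G x := by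
  intro ε hε
  obtain ⟨P, hP, h1⟩ := hF (ε / 2) (by positivity)
  obtain ⟨Q, hQ, h2⟩ := hG (ε / 2) (by positivity)
  refine ⟨P - Q, Submodule.sub_mem _ hP hQ, fun x => ?_⟩
  rw [Pi.sub_apply, sub_sub_sub_comm]
  have := norm_sub_le (F x - P x) (G x - Q x)
  linarith [h1 x, h2 x]

theorem translate (hF : IsBohrAlmostPeriodicFun F) (t : EuclideanSpace ℝ (Fin n)) :
    IsBohrAlmostPeriodicFun fun x => F (x + t) := by
  intro ε hε
  obtain ⟨P, hP, h⟩ := hF ε hε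
  exact ⟨_, translate_mem_trigPolynomials hP t, fun x => h (x + t)⟩

theorem star (hF : IsBohrAlmostPeriodicFun F) :
    IsBohrAlmostPeriodicFun fun x => (starRingEnd ℂ) (F x) := by
  intro ε hε
  obtain ⟨P, hP, h⟩ := hF ε hε
  refine ⟨_, star_mem_trigPolynomials hP, fun x => ?_⟩
  rw [← map_sub, RCLike.norm_conj]
  exact h x

theorem mul (hF : IsBohrAlmostPeriodicFun F) (hG : IsBohrAlmostPeriodicFun G) :
    IsBohrAlmostPeriodicFun fun x => F x * G x := by
  intro ε hε
  obtain ⟨C, hC, hFC⟩ := hF.bounded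
  obtain ⟨Q, hQ, h2⟩ := hG (ε / (2 * (C + 1))) (by positivity)
  obtain ⟨D, hD⟩ := bounded_of_mem_trigPolynomials hQ
  have hD0 : 0 ≤ D := (norm_nonneg _).trans (hD 0)
  -- `P` is chosen after `Q` because its tolerance depends on the bound `D` of `Q`.
  obtain ⟨P, hP, h1⟩ := hF (ε / (2 * (D + 1))) (by positivity)
  refine ⟨_, mul_mem_trigPolynomials hP hQ, fun x => ?_⟩
  have : F x * G x - P x * Q x = F x * (G x - Q x) + (F x - P x) * Q x := by ring
  rw [this]
  refine (norm_add_le _ _).trans_lt ?_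
  rw [norm_mul, norm_mul]
  have a1 : ‖F x‖ * ‖G x - Q x‖ < ε / 2 := by
    calc ‖F x‖ * ‖G x - Q x‖ ≤ C * ‖G x - Q x‖ := by gcongr; exact hFC x
      _ ≤ C * (ε / (2 * (C + 1))) := by gcongr; exact (h2 x).le
      _ < (C + 1) * (ε / (2 * (C + 1))) := by gcongr; linarith
      _ = ε / 2 := by field_simp
  have a2 : ‖F x - P x‖ * ‖Q x‖ < ε / 2 := by
    calc ‖F x - P x‖ * ‖Q x‖ ≤ ‖F x - P x‖ * D := by gcongr; exact hD x
      _ ≤ (ε / (2 * (D + 1))) * D := by gcongr; exact (h1 x).le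
      _ < (ε / (2 * (D + 1))) * (D + 1) := by gcongr; linarith
      _ = ε / 2 := by field_simp
  linarith

end IsBohrAlmostPeriodicFun

end AlmostPeriodicFunctions

/-! ### From convergence of characters to uniform convergence of translates. -/

section ReturnTimes

open MeasureTheory Filter Topology Metric

variable {n : ℕ}

/-- The limit of the means of `F` over large balls. -/
noncomputable def bohrMean (F : EuclideanSpace ℝ (Fin n) → ℂ) : ℂ := limUnder atTop (ballMean F)

theorem HasMean.bohrMean_eq {F : EuclideanSpace ℝ (Fin n) → ℂ} {a : ℂ} (h : HasMean F a) :
    bohrMean F = a := Tendsto.limUnder_eq h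

namespace IsBohrAlmostPeriodicFun

variable {F : EuclideanSpace ℝ (Fin n) → ℂ}

theorem hasMean_bohrMean (hF : IsBohrAlmostPeriodicFun F) : HasMean F (bohrMean F) := by
  obtain ⟨a, ha⟩ := hF.exists_hasMean
  rwa [ha.bohrMean_eq]

theorem hasMean_translate (hF : IsBohrAlmostPeriodicFun F) {a : ℂ} (ha : HasMean F a)
    (t : EuclideanSpace ℝ (Fin n)) : HasMean (fun x => F (x + t)) a := by
  obtain ⟨C, -, hC⟩ := hF.bounded
  exact ha.translate hF.continuous hC t

/-- If along a filter of translations every character either tends to `1` or does not occur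
in `F`, the translates of `F` do not change asymptotically as seen by trigonometric polynomials. -/
theorem tendsto_bohrMean_sub_mul (hF : IsBohrAlmostPeriodicFun F)
    {l : Filter (EuclideanSpace ℝ (Fin n))}
    (hl : ∀ y, Tendsto (character y) l (𝓝 1) ∨ HasMean (fun x => F x * character (-y) x) 0)
    {P : EuclideanSpace ℝ (Fin n) → ℂ} (hP : P ∈ trigPolynomials n) :
    Tendsto (fun t => bohrMean fun x =>
      (F (x + t) - F x) * (starRingEnd ℂ) (P (x + t) - P x)) l (𝓝 0) := by
  have hap : ∀ t, ∀ Q ∈ trigPolynomials n, IsBohrAlmostPeriodicFun fun x =>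
      (F (x + t) - F x) * (starRingEnd ℂ) (Q (x + t) - Q x) := by
    intro t Q hQ
    have hQ' := of_mem_trigPolynomials hQ
    exact ((hF.translate t).sub hF).mul ((hQ'.translate t).sub hQ').star
  induction hP using trigPolynomials.induction with
  | char y =>
    have hH : IsBohrAlmostPeriodicFun fun x => F x * character (-y) x :=
      hF.mul (of_mem_trigPolynomials (character_mem_trigPolynomials (-y)))
    obtain ⟨a, ha⟩ := hH.exists_hasMean
    -- The conjugate of `χ_y(x + t) - χ_y(x)` is `(χ_{-y}(t) - 1) χ_{-y}(x)`, and translation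
    -- invariance gives `F(x + t) χ_{-y}(x)` the mean `χ_y(t) a`. The result tends to `0` if `χ_y(t)
    -- → 1`, and vanishes if `a = 0`.
    have hval : ∀ t, (bohrMean fun x =>
        (F (x + t) - F x) * (starRingEnd ℂ) (character y (x + t) - character y x))
        = (character (-y) t - 1) * (character y t * a - a) := by
      intro t
      refine HasMean.bohrMean_eq ?_
      have h1 := (((hH.hasMean_translate ha t).const_mul (character y t)).sub ha
        (continuous_const.mul (hH.translate t).continuous) hH.continuous).const_mul
        (character (-y) t - 1)
      convert h1 using 2 with x
      rw [map_sub, star_character, star_character, character_add_right]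
      linear_combination (-(F (x + t)) * character (-y) x * (character (-y) t - 1)) *
        character_mul_neg y t
    simp only [hval]
    rcases hl y with h | h
    · have h2 : Tendsto (character (-y)) l (𝓝 1) := by
        have := (Complex.continuous_conj.tendsto 1).comp h
        simpa [Function.comp_def, star_character] using this
      simpa using (h2.sub_const 1).mul ((h.mul_const a).sub_const a)
    · rw [ha.unique h]
      simpa using tendsto_const_nhds
  | zero =>
    have : (bohrMean fun _ : EuclideanSpace ℝ (Fin n) => (0 : ℂ)) = 0 :=
      (hasMean_const 0).bohrMean_eq
    simpa [this] using tendsto_const_nhds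
  | add P hP Q hQ h1 h2 =>
    have hadd := h1.add h2
    rw [add_zero] at hadd
    refine hadd.congr fun t => ?_
    refine (HasMean.bohrMean_eq ?_).symm
    have := (hap t P hP).hasMean_bohrMean.add (hap t Q hQ).hasMean_bohrMean
      (hap t P hP).continuous (hap t Q hQ).continuous
    convert this using 2 with x
    simp only [map_sub, map_add]
    ring
  | mul c P hP h =>
    have hmul := h.const_mul ((starRingEnd ℂ) c)
    rw [mul_zero] at hmul
    refine hmul.congr fun t => ?_
    refine (HasMean.bohrMean_eq ?_).symm
    have := (hap t P hP).hasMean_bohrMean.const_mul ((starRingEnd ℂ) c)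
    convert this using 2 with x
    simp only [map_sub, map_mul]
    ring

theorem tendsto_bohrMean_norm_sq (hF : IsBohrAlmostPeriodicFun F)
    {l : Filter (EuclideanSpace ℝ (Fin n))}
    (hl : ∀ y, Tendsto (character y) l (𝓝 1) ∨ HasMean (fun x => F x * character (-y) x) 0) :
    Tendsto (fun t => bohrMean fun x =>
      (F (x + t) - F x) * (starRingEnd ℂ) (F (x + t) - F x)) l (𝓝 0) := by
  obtain ⟨C, hC, hFC⟩ := hF.bounded
  rw [Metric.tendsto_nhds]
  intro ε hε
  -- Replacing `F` by `P` in the conjugated factor costs at most `2(C + 1) · 2ε / (8(C + 1)) = ε /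
  -- 2`.
  obtain ⟨P, hP, hFP⟩ := hF (ε / (8 * (C + 1))) (by positivity)
  have hP' := of_mem_trigPolynomials hP
  have hlim := Metric.tendsto_nhds.1 (hF.tendsto_bohrMean_sub_mul hl hP) (ε / 2) (by positivity)
  filter_upwards [hlim] with t ht
  rw [dist_zero_right] at ht ⊢
  have hD := (hF.translate t).sub hF
  have hQ := (hP'.translate t).sub hP'
  have h1 := hD.mul hD.star
  have h2 := hD.mul hQ.star
  have h3 := h1.hasMean_bohrMean.sub h2.hasMean_bohrMean h1.continuous h2.continuous
  have h4 := h3.norm_le (C := ε / 2) fun x => by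
    rw [← mul_sub, ← map_sub, norm_mul, RCLike.norm_conj]
    have e1 : F (x + t) - F x - (P (x + t) - P x) =
      (F (x + t) - P (x + t)) - (F x - P x) := by ring
    have e2 : ‖F (x + t) - F x - (P (x + t) - P x)‖ ≤ 2 * (ε / (8 * (C + 1))) := by
      rw [e1]
      have := norm_sub_le (F (x + t) - P (x + t)) (F x - P x)
      linarith [hFP (x + t), hFP x]
    have e3 : ‖F (x + t) - F x‖ ≤ 2 * (C + 1) := by
      have := norm_sub_le (F (x + t)) (F x)
      linarith [hFC (x + t), hFC x]
    calc _ ≤ (2 * (C + 1)) * (2 * (ε / (8 * (C + 1)))) := by gcongr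
      _ = ε / 2 := by field_simp; norm_num
  have h5 := norm_le_norm_add_norm_sub' (bohrMean fun x =>
      (F (x + t) - F x) * (starRingEnd ℂ) (F (x + t) - F x)) (bohrMean fun x =>
      (F (x + t) - F x) * (starRingEnd ℂ) (P (x + t) - P x))
  linarith

/-- The quadratic mean of `F (· + t) - F` controls its uniform norm, uniformly in `t`. -/
theorem exists_forall_le_re_bohrMean (hF : IsBohrAlmostPeriodicFun F) {c : ℝ} (hc : 0 < c) :
    ∃ κ : ℝ, 0 < κ ∧ ∀ t x₀, c ≤ ‖F (x₀ + t) - F x₀‖ →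
      κ ≤ (bohrMean fun x => (F (x + t) - F x) * (starRingEnd ℂ) (F (x + t) - F x)).re := by
  classical
  -- If `x` and `τ (col x)` have the same colour, shifting by their difference moves `F` by at most
  -- `c / 4`. So at every `x`, one of finitely many translates of `D` has size at least `c / 2`. All
  -- translates of `|D|²` have the same mean, hence the bound `(c / 2)²` divided by the number of
  -- colours.
  obtain ⟨ι, hι, col, hcol⟩ := hF.hasPrecompactTranslates (c / 4) (by positivity)
  have := Fintype.ofFinite ι
  have hrep : ∃ τ : ι → EuclideanSpace ℝ (Fin n), ∀ s, col (τ (col s)) = col s := by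
    refine ⟨Function.invFun col, fun s => ?_⟩
    exact Function.invFun_eq ⟨s, rfl⟩
  obtain ⟨τ, hτ⟩ := hrep
  have hN : 0 < (Fintype.card ι : ℝ) := by
    exact_mod_cast Fintype.card_pos_iff.2 ⟨col 0⟩
  refine ⟨(c / 2) ^ 2 / Fintype.card ι, by positivity, fun t x₀ hx₀ => ?_⟩
  have hD := (hF.translate t).sub hF
  have hG := hD.mul hD.star
  set D : EuclideanSpace ℝ (Fin n) → ℂ := fun x => F (x + t) - F x with hDdef
  have hre : ∀ x, (D x * (starRingEnd ℂ) (D x)).re = ‖D x‖ ^ 2 := by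
    intro x
    rw [Complex.mul_conj, Complex.normSq_eq_norm_sq]
    norm_cast
  have hsum := HasMean.sum Finset.univ (F := fun i x => D (x + (x₀ - τ i)) *
    (starRingEnd ℂ) (D (x + (x₀ - τ i))))
    (fun i _ => hG.hasMean_translate hG.hasMean_bohrMean (x₀ - τ i))
    (fun i _ => (hG.translate (x₀ - τ i)).continuous)
  have hle := hsum.le_re (c := (c / 2) ^ 2)
    (continuous_finsetSum _ fun i _ => (hG.translate (x₀ - τ i)).continuous) fun x => by
      rw [Complex.re_sum]
      have hone : (c / 2) ^ 2 ≤ ‖D (x + (x₀ - τ (col x)))‖ ^ 2 := by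
        have hcl : ∀ z, ‖F (z + (x - τ (col x))) - F z‖ ≤ c / 4 := by
          intro z
          have := hcol x (τ (col x)) (hτ x).symm (z - τ (col x))
          rw [sub_add_cancel] at this
          convert this using 4
          abel
        have a1 := hcl (x₀ + t)
        have a2 := hcl x₀
        have e1 : D (x + (x₀ - τ (col x))) = D x₀ + ((F (x₀ + t + (x - τ (col x))) - F (x₀ + t))
            - (F (x₀ + (x - τ (col x))) - F x₀)) := by
          have b1 : x + (x₀ - τ (col x)) + t = x₀ + t + (x - τ (col x)) := by abel
          have b2 : x + (x₀ - τ (col x)) = x₀ + (x - τ (col x)) := by abel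
          simp only [hDdef, b1]
          rw [b2]
          ring
        have a3 := norm_sub_le (F (x₀ + t + (x - τ (col x))) - F (x₀ + t))
          (F (x₀ + (x - τ (col x))) - F x₀)
        have a4 := norm_sub_le_norm_add (D x₀) ((F (x₀ + t + (x - τ (col x))) - F (x₀ + t))
            - (F (x₀ + (x - τ (col x))) - F x₀))
        rw [← e1] at a4
        have a5 : c ≤ ‖D x₀‖ := hx₀
        gcongr
        linarith
      refine hone.trans ?_
      rw [← hre]
      refine Finset.single_le_sum (f := fun i => (D (x + (x₀ - τ i)) *
        (starRingEnd ℂ) (D (x + (x₀ - τ i)))).re) (fun i _ => ?_) (Finset.mem_univ (col x))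
      simp only [hre]
      positivity
  rw [Finset.sum_const, Finset.card_univ, nsmul_eq_mul, ← Complex.ofReal_natCast,
    Complex.re_ofReal_mul] at hle
  rw [div_le_iff₀ hN]
  linarith

/-- The quadratic mean tends to `0` along `l`, whereas a single value of size `ε` would keep it
above a fixed `κ`. No approximation of `F` by polynomials with frequencies in its own spectrum is
needed. -/
theorem eventually_norm_translate_sub_lt (hF : IsBohrAlmostPeriodicFun F)
    {l : Filter (EuclideanSpace ℝ (Fin n))}
    (hl : ∀ y, Tendsto (character y) l (𝓝 1) ∨ HasMean (fun x => F x * character (-y) x) 0)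
    {ε : ℝ} (hε : 0 < ε) : ∀ᶠ t in l, ∀ x, ‖F (x + t) - F x‖ < ε := by
  obtain ⟨κ, hκ, hκF⟩ := hF.exists_forall_le_re_bohrMean hε
  filter_upwards [Metric.tendsto_nhds.1 (hF.tendsto_bohrMean_norm_sq hl) κ hκ] with t ht x
  by_contra! hx
  rw [dist_zero_right] at ht
  exact absurd ((hκF t x hx).trans (Complex.re_le_norm _)) (not_le.2 ht)

end IsBohrAlmostPeriodicFun

/-- For `y = Mᵀ k` the character is the monomial `∏ z_j ^ k_j` composed with `ψ`, and the monomial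
is continuous on the torus. -/
theorem tendsto_character_of_mem_frequencyGroup {m : ℕ}
    {ψ : EuclideanSpace ℝ (Fin n) → (Fin m → Circle)}
    {M : EuclideanSpace ℝ (Fin n) →ₗ[ℝ] EuclideanSpace ℝ (Fin m)}
    (hM : ∀ x, ψ x = torusCover (M x)) {y : EuclideanSpace ℝ (Fin n)}
    (hy : y ∈ frequencyGroup M) : Tendsto (character y) (comap ψ (𝓝 1)) (𝓝 1) := by
  obtain ⟨k, rfl⟩ := hy
  have hfac : character (LinearMap.adjoint M (WithLp.toLp 2 fun j => (k j : ℝ))) =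
      (fun z : Fin m → Circle => ∏ j, ((z j ^ k j : Circle) : ℂ)) ∘ ψ := by
    funext t
    rw [character, LinearMap.adjoint_inner_left, Function.comp_apply, hM]
    simp only [torusCover, Circle.coe_zpow, Circle.coe_exp, ← Complex.exp_int_mul]
    rw [← Complex.exp_sum]
    congr 1
    rw [PiLp.inner_apply]
    push_cast
    rw [Finset.mul_sum]
    refine Finset.sum_congr rfl fun j _ => ?_
    simp
    ring
  rw [hfac]
  have hcont : Continuous fun z : Fin m → Circle => ∏ j, ((z j ^ k j : Circle) : ℂ) := by
    simp only [Circle.coe_zpow]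
    refine continuous_finsetProd _ fun j _ => ?_
    exact (continuous_subtype_val.comp (continuous_apply j)).zpow₀ _ fun z =>
      Or.inl (Circle.coe_ne_zero _)
  have := (hcont.tendsto 1).comp (tendsto_comap (f := ψ))
  simpa using this

end ReturnTimes

/-! ### Fourier coefficients of `μ * f` and of `μ`. -/

section ConvolutionCoefficients

open MeasureTheory Filter Topology Metric

variable {n : ℕ} {Λ : Set (EuclideanSpace ℝ (Fin n))} {s : ℝ}

theorem finite_inter_ball_of_separated (hs : 0 < s)
    (hΛ : ∀ p ∈ Λ, ∀ q ∈ Λ, dist p q < s → p = q) (R : ℝ) : (Λ ∩ ball 0 R).Finite := by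
  obtain ⟨T, -, hT, hcov⟩ := finite_cover_balls_of_compact
    (isCompact_closedBall (0 : EuclideanSpace ℝ (Fin n)) R) (e := s / 2) (by positivity)
  refine (hT.biUnion fun z _ => Set.Subsingleton.finite (s := Λ ∩ ball z (s / 2)) ?_).subset ?_
  · rintro p ⟨hp, hpz⟩ q ⟨hq, hqz⟩
    refine hΛ p hp q hq ?_
    have := dist_triangle_right p q z
    rw [mem_ball] at hpz hqz
    linarith
  · rintro p ⟨hp, hpR⟩
    have := hcov (ball_subset_closedBall hpR)
    simp only [Set.mem_iUnion] at this ⊢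
    obtain ⟨z, hz, hpz⟩ := this
    exact ⟨z, hz, hp, hpz⟩

/-- A packing bound: disjoint balls of radius `s / 2` around the points fit in a slightly thicker
annulus. It controls the points near the boundary of a large ball. -/
theorem card_mul_volume_ball_le (hs : 0 < s) (hΛ : ∀ p ∈ Λ, ∀ q ∈ Λ, dist p q < s → p = q)
    {a b : ℝ} (hab : b ≤ a) (A : Finset (EuclideanSpace ℝ (Fin n)))
    (hA : ∀ p ∈ A, p ∈ Λ ∧ ‖p‖ < a ∧ b ≤ ‖p‖) :
    A.card * volume.real (ball (0 : EuclideanSpace ℝ (Fin n)) (s / 2)) ≤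
      volume.real (ball (0 : EuclideanSpace ℝ (Fin n)) (a + s / 2)) -
        volume.real (ball (0 : EuclideanSpace ℝ (Fin n)) (b - s / 2)) := by
  have hdisj : (A : Set (EuclideanSpace ℝ (Fin n))).PairwiseDisjoint fun p => ball p (s / 2) := by
    intro p hp q hq hpq
    refine ball_disjoint_ball ?_
    by_contra! h
    exact hpq (hΛ p (hA p hp).1 q (hA q hq).1 (by linarith))
  have hunion := measureReal_biUnion_finset (μ := volume) hdisj (fun p _ => measurableSet_ball)
    (fun p _ => measure_ball_lt_top.ne)
  have hvol : ∀ p : EuclideanSpace ℝ (Fin n),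
      volume.real (ball p (s / 2)) = volume.real (ball (0 : EuclideanSpace ℝ (Fin n)) (s / 2)) := by
    intro p
    rw [measureReal_def, measureReal_def, Measure.addHaar_ball_center]
  simp only [hvol, Finset.sum_const, nsmul_eq_mul] at hunion
  rw [← hunion, ← measureReal_sdiff (ball_subset_ball (by linarith)) measurableSet_ball
    measure_ball_lt_top.ne]
  refine measureReal_mono ?_ ((measure_mono Set.sdiff_subset).trans_lt measure_ball_lt_top).ne
  refine Set.iUnion₂_subset fun p hp x hx => ?_
  obtain ⟨-, h1, h2⟩ := hA p hp
  rw [mem_ball, dist_eq_norm] at hx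
  refine ⟨?_, fun hx' => ?_⟩
  · rw [mem_ball_zero_iff]
    have := norm_le_norm_add_norm_sub' x p
    linarith
  · rw [mem_ball_zero_iff] at hx'
    have := norm_le_norm_add_norm_sub x p
    linarith

variable {f : EuclideanSpace ℝ (Fin n) → ℂ}

theorem norm_setIntegral_translate_mul_character_le (hf : Continuous f) (hfc : HasCompactSupport f)
    (y p : EuclideanSpace ℝ (Fin n)) (S : Set (EuclideanSpace ℝ (Fin n))) :
    ‖∫ x in S, f (x - p) * character y x‖ ≤ ∫ x, ‖f x‖ := by
  have hint : Integrable fun x => ‖f (x - p)‖ :=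
    (hf.integrable_of_hasCompactSupport hfc).norm.comp_sub_right p
  calc ‖∫ x in S, f (x - p) * character y x‖ ≤ ∫ x in S, ‖f (x - p) * character y x‖ :=
        norm_integral_le_integral_norm _
    _ = ∫ x in S, ‖f (x - p)‖ := by simp only [norm_mul, norm_character, mul_one]
    _ ≤ ∫ x, ‖f (x - p)‖ := setIntegral_le_integral hint (Eventually.of_forall fun _ => norm_nonneg _)
    _ = ∫ x, ‖f x‖ := integral_sub_right_eq_self (fun x => ‖f x‖) p

theorem integral_translate_mul_character (y p : EuclideanSpace ℝ (Fin n)) :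
    ∫ x, f (x - p) * character y x = character y p * ∫ x, f x * character y x := by
  rw [← integral_sub_right_eq_self (fun x => f x * character y x) p, ← integral_const_mul]
  congr 1
  funext x
  have : character y x = character y (x - p) * character y p := by
    rw [← character_add_right, sub_add_cancel]
  rw [this]
  ring

theorem convolve_eq_sum {R r : ℝ} (hfr : ∀ u, f u ≠ 0 → ‖u‖ < r)
    (hfin : (Λ ∩ ball 0 (R + r)).Finite) {x : EuclideanSpace ℝ (Fin n)} (hx : ‖x‖ < R) :
    convolve Λ f x = ∑ p ∈ hfin.toFinset, f (x - p) := by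
  rw [convolve]
  refine finsum_mem_eq_sum_of_inter_support_eq _ ?_
  ext p
  simp only [Set.mem_inter_iff, Function.mem_support, Set.Finite.coe_toFinset, mem_ball_zero_iff]
  constructor
  · rintro ⟨hp, hne⟩
    refine ⟨⟨hp, ?_⟩, hne⟩
    have h1 := hfr _ hne
    have := norm_le_norm_add_norm_sub x p
    linarith
  · rintro ⟨⟨hp, -⟩, hne⟩
    exact ⟨hp, hne⟩

/-- A point `p` with `‖p‖ < R - r` contributes equally to both terms, and one with `‖p‖ ≥ R + r`
contributes to neither. Each point in between costs at most twice the `L¹` norm of `f`, and the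
packing bound counts them. -/
theorem norm_setIntegral_convolve_sub_le (hs : 0 < s)
    (hΛ : ∀ p ∈ Λ, ∀ q ∈ Λ, dist p q < s → p = q) (hf : Continuous f) (hfc : HasCompactSupport f)
    {r : ℝ} (hr : 0 ≤ r) (hfr : ∀ u, f u ≠ 0 → ‖u‖ < r) (y : EuclideanSpace ℝ (Fin n)) (R : ℝ) :
    ‖(∫ x in ball 0 R, convolve Λ f x * character y x) -
      (∫ x, f x * character y x) * ∑ᶠ p ∈ Λ ∩ ball 0 R, character y p‖ *
        volume.real (ball (0 : EuclideanSpace ℝ (Fin n)) (s / 2)) ≤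
    (2 * ∫ x, ‖f x‖) * (volume.real (ball (0 : EuclideanSpace ℝ (Fin n)) (R + (r + s / 2))) -
        volume.real (ball (0 : EuclideanSpace ℝ (Fin n)) (R + -(r + s / 2)))) := by
  classical
  have hfin := finite_inter_ball_of_separated hs hΛ
  set N := (hfin (R + r)).toFinset with hN
  have hNmem : ∀ p, p ∈ N ↔ p ∈ Λ ∧ ‖p‖ < R + r := by simp [hN]
  set c := ∫ x, f x * character y x with hc
  set I := fun p => ∫ x in ball 0 R, f (x - p) * character y x with hI
  have hsumI : (∫ x in ball 0 R, convolve Λ f x * character y x) = ∑ p ∈ N, I p := by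
    rw [← integral_finsetSum]
    · refine setIntegral_congr_fun measurableSet_ball fun x hx => ?_
      rw [mem_ball_zero_iff] at hx
      simp only [convolve_eq_sum hfr (hfin (R + r)) hx, Finset.sum_mul, hN]
    · intro p _
      refine Continuous.integrableOn_metric_ball ?_ 0 R
      exact (hf.comp (continuous_sub_right p)).mul (continuous_character y)
  have hsumJ : c * (∑ᶠ p ∈ Λ ∩ ball 0 R, character y p) =
      ∑ p ∈ N, if ‖p‖ < R then character y p * c else 0 := by
    rw [finsum_mem_eq_finite_toFinset_sum _ (hfin R), Finset.mul_sum, ← Finset.sum_filter]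
    refine Finset.sum_congr ?_ fun p _ => mul_comm _ _
    ext p
    simp only [Set.Finite.mem_toFinset, Set.mem_inter_iff, mem_ball_zero_iff, Finset.mem_filter,
      hNmem]
    constructor
    · rintro ⟨h1, h2⟩
      exact ⟨⟨h1, by linarith⟩, h2⟩
    · rintro ⟨⟨h1, -⟩, h2⟩
      exact ⟨h1, h2⟩
  set d := fun p => I p - if ‖p‖ < R then character y p * c else 0 with hd
  have hdzero : ∀ p, ‖p‖ < R - r → d p = 0 := by
    intro p hp
    have h1 : I p = character y p * c := by
      rw [hc, ← integral_translate_mul_character]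
      refine setIntegral_eq_integral_of_forall_compl_eq_zero fun x hx => ?_
      by_contra hne
      have h2 := hfr _ (left_ne_zero_of_mul hne)
      rw [mem_ball_zero_iff, not_lt] at hx
      have := norm_le_norm_add_norm_sub' x p
      linarith
    simp only [hd]
    rw [if_pos (by linarith), h1, sub_self]
  have hdnorm : ∀ p, ‖d p‖ ≤ 2 * ∫ x, ‖f x‖ := by
    intro p
    have h1 : ‖I p‖ ≤ ∫ x, ‖f x‖ :=
      norm_setIntegral_translate_mul_character_le hf hfc y p _
    have h2 : ‖if ‖p‖ < R then character y p * c else 0‖ ≤ ∫ x, ‖f x‖ := by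
      split_ifs
      · have := norm_setIntegral_translate_mul_character_le hf hfc y 0 Set.univ
        rw [norm_mul, norm_character, one_mul]
        simpa using this
      · rw [norm_zero]
        positivity
    refine (norm_sub_le _ _).trans ?_
    linarith
  have hsum : (∫ x in ball 0 R, convolve Λ f x * character y x) -
      c * ∑ᶠ p ∈ Λ ∩ ball 0 R, character y p = ∑ p ∈ N with R - r ≤ ‖p‖, d p := by
    rw [hsumI, hsumJ, ← Finset.sum_sub_distrib, Finset.sum_filter]
    refine Finset.sum_congr rfl fun p _ => ?_
    by_cases h : R - r ≤ ‖p‖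
    · rw [if_pos h]
    · rw [if_neg h]
      exact hdzero p (not_le.1 h)
  have hcard := card_mul_volume_ball_le hs hΛ (a := R + r) (b := R - r) (by linarith)
    (N.filter fun p => R - r ≤ ‖p‖) fun p hp => by
      rw [Finset.mem_filter, hNmem] at hp
      exact ⟨hp.1.1, hp.1.2, hp.2⟩
  have e1 : R + r + s / 2 = R + (r + s / 2) := by ring
  have e2 : R - r - s / 2 = R + -(r + s / 2) := by ring
  rw [e1, e2] at hcard
  rw [hsum]
  have hA : 0 ≤ 2 * ∫ x, ‖f x‖ := by positivity
  refine le_trans ?_ (mul_le_mul_of_nonneg_left hcard hA)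
  rw [← mul_assoc]
  refine mul_le_mul_of_nonneg_right ?_ measureReal_nonneg
  refine (norm_sum_le_of_le _ fun p _ => hdnorm p).trans ?_
  rw [Finset.sum_const, nsmul_eq_mul, mul_comm]

theorem exists_norm_lt_of_hasCompactSupport (hfc : HasCompactSupport f) :
    ∃ r, 0 ≤ r ∧ ∀ u, f u ≠ 0 → ‖u‖ < r := by
  obtain ⟨C, hC⟩ := hfc.isCompact.isBounded.exists_norm_le
  refine ⟨max C 0 + 1, by positivity, fun u hu => ?_⟩
  have := hC u (subset_tsupport f hu)
  linarith [le_max_left C 0]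

/-- The coefficient of `μ * f` at `y` is that of `μ` times an integral of `f`. Phrased as a
difference, this presupposes the existence of neither limit. -/
theorem tendsto_ballMean_convolve_sub (hs : 0 < s)
    (hΛ : ∀ p ∈ Λ, ∀ q ∈ Λ, dist p q < s → p = q) (hf : Continuous f) (hfc : HasCompactSupport f)
    (y : EuclideanSpace ℝ (Fin n)) :
    Tendsto (fun R => ballMean (fun x => convolve Λ f x * character (-y) x) R -
      (∫ x, f x * character (-y) x) * ballAverage Λ y R) atTop (𝓝 0) := by
  obtain ⟨r, hr, hfr⟩ := exists_norm_lt_of_hasCompactSupport hfc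
  set v := volume.real (ball (0 : EuclideanSpace ℝ (Fin n)) (s / 2)) with hv
  have hvpos : 0 < v := volume_real_ball_pos _ (by positivity)
  have hlim := (tendsto_volume_annulus_div (E := EuclideanSpace ℝ (Fin n)) (r + s / 2)
    (-(r + s / 2))).const_mul ((2 * ∫ x, ‖f x‖) / v)
  rw [mul_zero] at hlim
  refine squeeze_zero_norm' ?_ hlim
  filter_upwards [eventually_gt_atTop 0] with R hR
  have hV := volume_real_ball_pos (0 : EuclideanSpace ℝ (Fin n)) hR
  have hmain := norm_setIntegral_convolve_sub_le hs hΛ hf hfc hr hfr (-y) R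
  have heq : ballMean (fun x => convolve Λ f x * character (-y) x) R -
      (∫ x, f x * character (-y) x) * ballAverage Λ y R =
      (volume.real (ball (0 : EuclideanSpace ℝ (Fin n)) R))⁻¹ •
        ((∫ x in ball 0 R, convolve Λ f x * character (-y) x) -
      (∫ x, f x * character (-y) x) * ∑ᶠ p ∈ Λ ∩ ball 0 R, character (-y) p) := by
    rw [ballMean_eq, smul_sub, ballAverage, ← measureReal_def]
    congr 1
    rw [Complex.real_smul, Complex.ofReal_inv]
    ring
  rw [heq, norm_smul, norm_inv, Real.norm_of_nonneg hV.le, ← div_eq_inv_mul, div_mul_div_comm,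
    div_le_div_iff₀ hV (by positivity)]
  rw [← mul_assoc]
  exact mul_le_mul_of_nonneg_right hmain hV.le

theorem exists_integral_mul_character_ne_zero (y : EuclideanSpace ℝ (Fin n)) :
    ∃ f : EuclideanSpace ℝ (Fin n) → ℂ, Continuous f ∧ HasCompactSupport f ∧
      ∫ x, f x * character y x ≠ 0 := by
  let b : ContDiffBump (0 : EuclideanSpace ℝ (Fin n)) := default
  refine ⟨fun x => (b x : ℂ) * character (-y) x, ?_, ?_, ?_⟩
  · exact (Complex.continuous_ofReal.comp b.continuous).mul (continuous_character _)
  · exact (b.hasCompactSupport.comp_left Complex.ofReal_zero).mul_right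
  · have : ∀ x, (b x : ℂ) * character (-y) x * character y x = (b x : ℂ) := by
      intro x
      rw [mul_assoc, mul_comm (character (-y) x), character_mul_neg, mul_one]
    simp only [this]
    rw [integral_complex_ofReal]
    exact_mod_cast b.integral_pos.ne'

/-- The Fourier coefficients of `μ * f` vanish outside the spectrum of `μ`. -/
theorem hasMean_convolve_mul_character_of_notMem (hs : 0 < s)
    (hΛ : ∀ p ∈ Λ, ∀ q ∈ Λ, dist p q < s → p = q) (hAP : IsBohrAlmostPeriodicSet Λ)
    (hf : Continuous f) (hfc : HasCompactSupport f) {y : EuclideanSpace ℝ (Fin n)}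
    (hy : y ∉ pointSpectrum Λ) : HasMean (fun x => convolve Λ f x * character (-y) x) 0 := by
  -- Outside the spectrum the averages of `μ` could a priori diverge. Dividing the existing mean for
  -- `μ * g` by the nonzero integral of `g` excludes this, so their limit exists and is `0`.
  obtain ⟨g, hg, hgc, hg0⟩ := exists_integral_mul_character_ne_zero (-y)
  obtain ⟨a, ha⟩ := ((hAP g hg hgc).mul
    (.of_mem_trigPolynomials (character_mem_trigPolynomials (-y)))).exists_hasMean
  have h1 := (Tendsto.sub ha (tendsto_ballMean_convolve_sub hs hΛ hg hgc y)).const_mul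
    (∫ x, g x * character (-y) x)⁻¹
  simp only [sub_sub_cancel, inv_mul_cancel_left₀ hg0, sub_zero] at h1
  have h2 : (∫ x, g x * character (-y) x)⁻¹ * a = 0 := by
    by_contra hne
    exact hy ⟨_, hne, h1⟩
  rw [h2] at h1
  have h3 := (tendsto_ballMean_convolve_sub hs hΛ hf hfc y).add
    (h1.const_mul (∫ x, f x * character (-y) x))
  simpa [HasMean] using h3

end ConvolutionCoefficients

/-! ### Almost periods of `Λ` and the geometry of the preimage of `K`. -/

section ToralType

open Filter Topology Metric Pointwise

variable {n m : ℕ} {Λ : Set (EuclideanSpace ℝ (Fin n))} {s : ℝ}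

/-- The vectors `t` for which every point of `Λ + t` is at distance less than `ε` from `Λ`. -/
def almostPeriods (Λ : Set (EuclideanSpace ℝ (Fin n))) (ε : ℝ) : Set (EuclideanSpace ℝ (Fin n)) :=
  {t | ∀ p ∈ Λ, ∃ q ∈ Λ, ‖p + t - q‖ < ε}

/-- At `p ∈ Λ` the sum of bumps is at least `1`, whereas it would be `0` at `p + t` if no point of
`Λ` were near. -/
theorem mem_almostPeriods_of_convolve_bump (hs : 0 < s)
    (hΛ : ∀ p ∈ Λ, ∀ q ∈ Λ, dist p q < s → p = q)
    (b : ContDiffBump (0 : EuclideanSpace ℝ (Fin n))) {t : EuclideanSpace ℝ (Fin n)}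
    (ht : ∀ x, ‖convolve Λ (fun u => (b u : ℂ)) (x + t) - convolve Λ (fun u => (b u : ℂ)) x‖ < 1) :
    t ∈ almostPeriods Λ b.rOut := by
  intro p hp
  by_contra! hfar
  have hbr : ∀ u, (b u : ℂ) ≠ 0 → ‖u‖ < b.rOut := by
    intro u hu
    by_contra! h
    exact hu (by rw [b.zero_of_le_dist (by simpa using h)]; simp)
  have hzero : convolve Λ (fun u => (b u : ℂ)) (p + t) = 0 := by
    rw [convolve]
    refine finsum_mem_eq_zero_of_forall_eq_zero fun q hq => ?_
    by_contra hne
    exact absurd (hbr _ hne) (not_lt.2 (hfar q hq))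
  have hone : 1 ≤ ‖convolve Λ (fun u => (b u : ℂ)) p‖ := by
    have hfin := finite_inter_ball_of_separated hs hΛ (‖p‖ + 1 + b.rOut)
    rw [convolve_eq_sum (R := ‖p‖ + 1) hbr hfin (by linarith)]
    refine le_trans ?_ (Complex.re_le_norm _)
    rw [Complex.re_sum]
    have hmem : p ∈ hfin.toFinset := by
      simp only [Set.Finite.mem_toFinset, Set.mem_inter_iff, mem_ball_zero_iff]
      exact ⟨hp, by linarith [b.rOut_pos]⟩
    have := Finset.single_le_sum (f := fun q => ((b (p - q) : ℝ) : ℂ).re)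
      (fun q _ => by simpa using b.nonneg) hmem
    refine le_trans ?_ this
    have h1 : b 0 = 1 := b.one_of_mem_closedBall (mem_closedBall_self b.rIn_pos.le)
    simp [h1]
  have := ht p
  rw [hzero, zero_sub, norm_neg] at this
  linarith

/-- Toral type enters here: each frequency either lies in `Mᵀ ℤᵐ`, where its character tends to `1`
as `ψ t → 1`, or lies off the spectrum and does not occur in `μ * f`. -/
theorem IsBohrAlmostPeriodicSet.almostPeriods_mem_comap (hs : 0 < s)
    (hΛ : ∀ p ∈ Λ, ∀ q ∈ Λ, dist p q < s → p = q) (hAP : IsBohrAlmostPeriodicSet Λ)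
    {ψ : EuclideanSpace ℝ (Fin n) → (Fin m → Circle)}
    {M : EuclideanSpace ℝ (Fin n) →ₗ[ℝ] EuclideanSpace ℝ (Fin m)}
    (hM : ∀ x, ψ x = torusCover (M x)) (hspec : pointSpectrum Λ ⊆ frequencyGroup M)
    {ε : ℝ} (hε : 0 < ε) : almostPeriods Λ ε ∈ comap ψ (𝓝 1) := by
  let b : ContDiffBump (0 : EuclideanSpace ℝ (Fin n)) := ⟨ε / 2, ε, by positivity, by linarith⟩
  have hf : Continuous fun u => (b u : ℂ) := Complex.continuous_ofReal.comp b.continuous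
  have hfc : HasCompactSupport fun u => (b u : ℂ) :=
    b.hasCompactSupport.comp_left Complex.ofReal_zero
  have hev := (hAP _ hf hfc).eventually_norm_translate_sub_lt (l := comap ψ (𝓝 1)) (fun y => ?_)
    one_pos
  · filter_upwards [hev] with t ht
    exact mem_almostPeriods_of_convolve_bump hs hΛ b ht
  · by_cases hy : y ∈ pointSpectrum Λ
    · exact Or.inl (tendsto_character_of_mem_frequencyGroup hM (hspec hy))
    · exact Or.inr (hasMean_convolve_mul_character_of_notMem hs hΛ hAP hf hfc hy)

theorem continuous_torusCover : Continuous (torusCover (m := m)) := by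
  unfold torusCover
  fun_prop

theorem torusCover_add (x y : EuclideanSpace ℝ (Fin m)) :
    torusCover (x + y) = torusCover x * torusCover y := by
  funext j
  simp [torusCover, mul_add, Circle.exp_add]

theorem torusCover_zero : torusCover (0 : EuclideanSpace ℝ (Fin m)) = 1 := by
  funext j
  simp [torusCover]

variable {ψ : EuclideanSpace ℝ (Fin n) → (Fin m → Circle)}
  {M : EuclideanSpace ℝ (Fin n) →ₗ[ℝ] EuclideanSpace ℝ (Fin m)}

/-- The almost period carries `q` to `p + e`, which is then within `ε` of some `p' ∈ Λ`. Taking `ε =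
‖e‖`, discreteness forces `p' = p`, so `‖e‖ < ‖e‖`. -/
theorem eq_zero_of_mem_almostPeriods (hΛ : ∀ p ∈ Λ, ∀ q ∈ Λ, dist p q < s → p = q)
    {e : EuclideanSpace ℝ (Fin n)} (he : ‖e‖ < s / 2)
    (h : ∀ ε, 0 < ε → ∃ p ∈ Λ, ∃ q ∈ Λ, p + e - q ∈ almostPeriods Λ ε) : e = 0 := by
  by_contra hne
  have he0 : 0 < ‖e‖ := norm_pos_iff.2 hne
  obtain ⟨p, hp, q, hq, hpq⟩ := h ‖e‖ he0
  obtain ⟨p', hp', hlt⟩ := hpq q hq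
  have h1 : q + (p + e - q) - p' = p - p' + e := by abel
  rw [h1] at hlt
  have h2 : p = p' := by
    refine hΛ p hp p' hp' ?_
    rw [dist_eq_norm]
    have := norm_sub_le (p - p' + e) e
    rw [add_sub_cancel_right] at this
    linarith
  rw [h2, sub_self, zero_add] at hlt
  exact lt_irrefl _ hlt

/-- A kernel vector of `M`, scaled to be short, has image `1` under `ψ` and so is an almost period
for every `ε`. -/
theorem injective_of_almostPeriods (hs : 0 < s) (hΛ : ∀ p ∈ Λ, ∀ q ∈ Λ, dist p q < s → p = q)
    (hne : Λ.Nonempty) (hM : ∀ x, ψ x = torusCover (M x))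
    (hper : ∀ ε, 0 < ε → almostPeriods Λ ε ∈ comap ψ (𝓝 1)) : Function.Injective M := by
  rw [injective_iff_map_eq_zero]
  intro t ht
  obtain ⟨p, hp⟩ := hne
  set c : ℝ := s / (4 * (‖t‖ + 1)) with hc
  have hcpos : 0 < c := by positivity
  have hsmall : ‖c • t‖ < s / 2 := by
    rw [norm_smul, Real.norm_of_nonneg hcpos.le]
    calc c * ‖t‖ ≤ c * (‖t‖ + 1) := by gcongr; linarith
      _ = s / 4 := by rw [hc]; field_simp
      _ < s / 2 := by linarith
  have hzero : c • t = 0 := by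
    refine eq_zero_of_mem_almostPeriods hΛ hsmall fun ε hε => ⟨p, hp, p, hp, ?_⟩
    rw [add_sub_cancel_left]
    obtain ⟨W, hW, hWsub⟩ := hper ε hε
    refine hWsub ?_
    rw [Set.mem_preimage, hM, map_smul, ht, smul_zero, torusCover_zero]
    exact mem_of_mem_nhds hW
  exact (smul_eq_zero.1 hzero).resolve_left hcpos.ne'

theorem isFollowedModulo_preimage_closure (hψ : IsToralCompactification ψ)
    (hM : ∀ x, ψ x = torusCover (M x))
    (hper : ∀ ε, 0 < ε → almostPeriods Λ ε ∈ comap ψ (𝓝 1)) :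
    IsFollowedModulo (torusCover ⁻¹' closure (ψ '' Λ)) (LinearMap.range M) := by
  intro ε hε
  obtain ⟨C, hC, hMC⟩ : ∃ C : ℝ, 0 < C ∧ ∀ e, ‖M e‖ ≤ C * ‖e‖ :=
    ⟨‖LinearMap.toContinuousLinearMap M‖ + 1, by positivity, fun e =>
      ((LinearMap.toContinuousLinearMap M).le_opNorm e).trans (by gcongr; linarith)⟩
  set η := ε / (2 * C) with hη
  have hηpos : 0 < η := by positivity
  obtain ⟨W, hW, hWsub⟩ := hper η hηpos
  obtain ⟨O, hOW, hO, hO1⟩ := _root_.mem_nhds_iff.1 hW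
  have hnhds : torusCover ⁻¹' O ∈ 𝓝 (0 : EuclideanSpace ℝ (Fin m)) :=
    (hO.preimage continuous_torusCover).mem_nhds (by rwa [Set.mem_preimage, torusCover_zero])
  obtain ⟨δ, hδ, hδO⟩ := Metric.mem_nhds_iff.1 hnhds
  refine ⟨δ, hδ, fun z hz w hw => ?_⟩
  -- For `p ∈ Λ` and `ψ t` near `1`, the point `p + t` is within `η` of `Λ`, so `ψ p * ψ t` lies in
  -- `A`. As a product of compact sets `A` is closed, so it also contains the limits `torusCover z *
  -- torusCover w`, with `w` approximated through the density of `ψ`.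
  set A : Set (Fin m → Circle) := closure (ψ '' Λ) * ψ '' closedBall 0 η with hA
  have hAclosed : IsClosed A :=
    (isClosed_closure.isCompact.mul ((isCompact_closedBall 0 η).image hψ.continuous)).isClosed
  have hw' : torusCover w ∈ closure (O ∩ Set.range ψ) :=
    hψ.dense.open_subset_closure_inter hO (hδO (mem_ball_zero_iff.2 hw))
  have hprod : torusCover z * torusCover w ∈ closure A := by
    refine map_mem_closure₂ continuous_mul hz hw' ?_
    rintro _ ⟨p, hp, rfl⟩ _ ⟨htO, t, rfl⟩
    obtain ⟨q, hq, hlt⟩ := hWsub (hOW htO : ψ t ∈ W) p hp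
    refine ⟨ψ q, subset_closure ⟨q, hq, rfl⟩, _, ⟨p + t - q, ?_, rfl⟩, ?_⟩
    · simpa using hlt.le
    · simp only [← hψ.map_add]
      congr 1
      abel
  rw [hAclosed.closure_eq] at hprod
  obtain ⟨k, hk, _, ⟨e, he, rfl⟩, hke⟩ := hprod
  refine ⟨M (-e), ⟨-e, rfl⟩, ?_, ?_⟩
  · rw [mem_closedBall_zero_iff] at he
    have h1 := hMC (-e)
    rw [norm_neg] at h1
    calc ‖M (-e)‖ ≤ C * ‖e‖ := h1
      _ ≤ C * η := by gcongr
      _ = ε / 2 := by rw [hη]; field_simp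
      _ < ε := by linarith
  · have hinv : ψ e * torusCover (M (-e)) = 1 := by
      rw [hM, ← torusCover_add, map_neg, add_neg_cancel, torusCover_zero]
    have : torusCover (z + w + M (-e)) = k := by
      rw [torusCover_add, torusCover_add]
      simp only at hke
      rw [← hke, mul_assoc, hinv, mul_one]
    rwa [Set.mem_preimage, this]

theorem exists_isSeparatedAlong_preimage_closure (hs : 0 < s)
    (hΛ : ∀ p ∈ Λ, ∀ q ∈ Λ, dist p q < s → p = q) (hψ : IsToralCompactification ψ)
    (hM : ∀ x, ψ x = torusCover (M x)) (hinj : Function.Injective M)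
    (hper : ∀ ε, 0 < ε → almostPeriods Λ ε ∈ comap ψ (𝓝 1)) :
    ∃ r, 0 < r ∧
      IsSeparatedAlong (torusCover ⁻¹' closure (ψ '' Λ)) (LinearMap.range M) r := by
  obtain ⟨κ, hκ, hanti⟩ := M.exists_antilipschitzWith (LinearMap.ker_eq_bot.2 hinj)
  have hκ' : (0 : ℝ) < κ := hκ
  -- With `κ` the antilipschitz constant of `M`, `‖M e‖ < s / (4κ)` gives `‖e‖ < s / 4`, within the
  -- range where discreteness applies.
  refine ⟨s / (4 * κ), by positivity, ?_⟩
  rintro z hz z' hz' ⟨e, he⟩ hlt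
  rw [← he] at hlt
  have hesmall : ‖e‖ < s / 4 := by
    have h1 : ‖e‖ ≤ κ * ‖M e‖ := by
      have := hanti.le_mul_dist e 0
      simpa using this
    calc ‖e‖ ≤ κ * ‖M e‖ := h1
      _ < κ * (s / (4 * κ)) := by gcongr
      _ = s / 4 := by field_simp
  have hclose : ∀ ε, 0 < ε → ∃ p ∈ Λ, ∃ q ∈ Λ, p + e - q ∈ almostPeriods Λ ε := by
    intro ε hε
    obtain ⟨W, hW, hWsub⟩ := hper ε hε
    -- Approximating the two points of `K` by `ψ p` and `ψ q` makes `ψ (p + e - q)` close to this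
    -- product, that is, to `1`.
    have hval : torusCover z * ψ e * (torusCover z')⁻¹ = 1 := by
      rw [hM, he, ← torusCover_add, add_sub_cancel, mul_inv_cancel]
    have hcont : Continuous fun a : (Fin m → Circle) × (Fin m → Circle) =>
        a.1 * ψ e * a.2⁻¹ := by fun_prop
    have hWpre : (fun a : (Fin m → Circle) × (Fin m → Circle) => a.1 * ψ e * a.2⁻¹) ⁻¹' W ∈
        𝓝 (torusCover z, torusCover z') := by
      refine hcont.continuousAt ?_
      simp only [hval]
      exact hW
    have hmem : (torusCover z, torusCover z') ∈ closure ((ψ '' Λ) ×ˢ (ψ '' Λ)) := by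
      rw [closure_prod_eq]
      exact ⟨hz, hz'⟩
    obtain ⟨⟨_, _⟩, haW, ⟨p, hp, rfl⟩, ⟨q, hq, rfl⟩⟩ := mem_closure_iff_nhds.1 hmem _ hWpre
    refine ⟨p, hp, q, hq, hWsub ?_⟩
    have : ψ (p + e - q) = ψ p * ψ e * (ψ q)⁻¹ := by
      rw [eq_mul_inv_iff_mul_eq, ← hψ.map_add, ← hψ.map_add, sub_add_cancel]
    rw [Set.mem_preimage, this]
    exact haW
  have he0 : e = 0 := eq_zero_of_mem_almostPeriods hΛ (by linarith) hclose
  rw [he0, map_zero] at he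
  exact (sub_eq_zero.1 he.symm)

/-- A connected subset of `g ⁻¹' K` through `x` has connected image, so it stays over the component
of `g x`. Thus `Hc` is a component of the full preimage of `K`. -/
theorem connectedComponentIn_preimage_connectedComponentIn {X Y : Type*} [TopologicalSpace X]
    [TopologicalSpace Y] {g : X → Y} (hg : Continuous g) {K : Set Y} {z : Y} {x : X}
    (hx : x ∈ g ⁻¹' connectedComponentIn K z) :
    connectedComponentIn (g ⁻¹' connectedComponentIn K z) x = connectedComponentIn (g ⁻¹' K) x := by
  have hxK : x ∈ g ⁻¹' K := connectedComponentIn_subset K z hx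
  refine (connectedComponentIn_mono x
    (Set.preimage_mono (connectedComponentIn_subset K z))).antisymm ?_
  refine isPreconnected_connectedComponentIn.subset_connectedComponentIn
    (mem_connectedComponentIn hxK) ?_
  rw [connectedComponentIn_eq hx, ← Set.image_subset_iff]
  refine (isPreconnected_connectedComponentIn.image g
    hg.continuousOn).subset_connectedComponentIn ⟨x, mem_connectedComponentIn hxK, rfl⟩ ?_
  rw [Set.image_subset_iff]
  exact connectedComponentIn_subset _ _

end ToralType

theorem theorem3 {n m : ℕ}
    (Λ : Delone.DeloneSet (EuclideanSpace ℝ (Fin n)))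
    (hΛ : IsBohrAlmostPeriodicSet (Λ : Set (EuclideanSpace ℝ (Fin n))))
    -- a toral compactification of `ℝⁿ`, with its linear lift `M`, that is associated with `Λ`
    (ψ : EuclideanSpace ℝ (Fin n) → (Fin m → Circle)) (hψ : IsToralCompactification ψ)
    (M : EuclideanSpace ℝ (Fin n) →ₗ[ℝ] EuclideanSpace ℝ (Fin m))
    (hM : ∀ x, ψ x = torusCover (M x))
    (hspec : pointSpectrum (Λ : Set (EuclideanSpace ℝ (Fin n))) ⊆ frequencyGroup M)
    -- `K`, and the subspaces `V` and `U`
    (K : Set (Fin m → Circle))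
    (hK : K = closure (ψ '' (Λ : Set (EuclideanSpace ℝ (Fin n)))))
    (V U : Submodule ℝ (EuclideanSpace ℝ (Fin m)))
    (hV : V = LinearMap.range M) (hU : U = Vᗮ) :
    Module.finrank ℝ U + n = m ∧
    -- for every component `Kc` of `K` and every component `Hc` of the preimage of `Kc`
    ∀ z ∈ K, ∀ Kc : Set (Fin m → Circle), Kc = connectedComponentIn K z →
    ∀ x ∈ torusCover ⁻¹' Kc, ∀ Hc : Set (EuclideanSpace ℝ (Fin m)),
      Hc = connectedComponentIn (torusCover ⁻¹' Kc) x →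
      ∃ h : U → V, Continuous h ∧
        ∃ e : U ≃ₜ Hc, ∀ u : U,
          (e u : EuclideanSpace ℝ (Fin m)) =
            (h u : EuclideanSpace ℝ (Fin m)) + (u : EuclideanSpace ℝ (Fin m)) := by
  have hs : (0 : ℝ) < Λ.packingRadius := Λ.packingRadius_pos
  have hsep : ∀ p ∈ (Λ : Set (EuclideanSpace ℝ (Fin n))), ∀ q ∈ (Λ : Set _),
      dist p q < Λ.packingRadius → p = q := by
    intro p hp q hq hlt
    by_contra hne
    exact lt_asymm hlt (Λ.packingRadius_lt_dist_of_mem_ne hp hq hne)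
  have hper := fun ε (hε : 0 < ε) => hΛ.almostPeriods_mem_comap hs hsep hM hspec hε
  have hinj := injective_of_almostPeriods hs hsep Λ.nonempty hM hper
  obtain ⟨r, hr, hsepX⟩ := exists_isSeparatedAlong_preimage_closure hs hsep hψ hM hinj hper
  have hfol := isFollowedModulo_preimage_closure hψ hM hper
  subst hK hV hU
  refine ⟨?_, ?_⟩
  · have h1 := (LinearMap.range M).finrank_add_finrank_orthogonal
    rw [LinearMap.finrank_range_of_inj hinj, finrank_euclideanSpace_fin,
      finrank_euclideanSpace_fin] at h1
    rw [add_comm]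
    exact h1
  · rintro z - Kc rfl x hx Hc rfl
    rw [connectedComponentIn_preimage_connectedComponentIn continuous_torusCover hx]
    exact exists_homeomorph_connectedComponentIn hsepX hr hfol
      (Set.preimage_mono (connectedComponentIn_subset _ _) hx)
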